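/- Let $M$ be a connected non-orientable smooth surface (without boundary) with a Riemannian metric. Let $\pi:\widetilde M\to M$ be its orientation double cover, whose points are the pairs $x'=(p,o)$ of a point $p\in M$ and an orientation $o$ of $T_pM$, and let $\tau(p,o)=(p,-o)$. Let $\mathrm{SDiff}(M)$ be the group of area-preserving diffeomorphisms of $M$; each $\phi\in\mathrm{SDiff}(M)$ lifts to $\widetilde\phi:\widetilde M\to\widetilde M$, $\widetilde\phi(p,o)=(\phi(p),(d\phi_p)_*o)$. Distributional 2-forms on $M$ are regarded as linear functionals on the twisted test functions, i.e. the smooth compactly supported $f:\widetilde M\to\mathbb R$ with $f\circ\tau=-f$, with the weak topology and with the pull-back $\langle\phi^*T,f\rangle=\langle T,f\circ\widetilde\phi^{-1}\rangle$. A point vortex of strength $1$ at $x'\in\widetilde M$ is the 2-form $\lambda_{x'}$ with $\langle\lambda_{x'},f\rangle=f(x')$; so $\lambda_{\tau(x')}=-\lambda_{x'}$. Fix $N\ge 0$ and nonzero real strengths $\Gamma_1,\dots,\Gamma_N$. Let $\widetilde\Delta\subset\widetilde M^N$ be the set of tuples $(x_1',\dots,x_N')$ with $\pi(x_i')=\pi(x_j')$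 for some $i\ne j$, let ${\boldsymbol\lambda}=\sum_j\Gamma_j\lambda_{a_j'}$ for some $(a_1',\dots,a_N')\in\widetilde M^N\setminus\widetilde\Delta$, and let $\mathcal O_{\boldsymbol\lambda}=\{\phi^*{\boldsymbol\lambda}\mid\phi\in\mathrm{SDiff}(M)\}$. Then the map $$P:\widetilde M^N\setminus\widetilde\Delta\to\mathcal O_{\boldsymbol\lambda},\qquad (x_1',\dots,x_N')\mapsto\sum_j\Gamma_j\lambda_{x_j'},$$ is a parametrization of the phase space $\mathcal O_{\boldsymbol\lambda}$ of the $N$ vortices, in the following sense. 1. $P$ is well defined (its values lie in $\mathcal O_{\boldsymbol\lambda}$), surjective, continuous and open. 2. $P(x')=P(y')$ if and only if there is a permutation $s$ of $\{1,\dots,N\}$ such that for each $j$ either $y'_{s(j)}=x'_j$ and $\Gamma_{s(j)}=\Gamma_j$, or $y'_{s(j)}=\tau(x'_j)$ and $\Gamma_{s(j)}=-\Gamma_j$. In particular, $P$ is a homeomorphism if the $|\Gamma_j|$ are pairwise distinct. 3. $P$ is a smooth immersion in the weak sense: for each twisted test function $f$ the function $x'\mapsto\langle P(x'),f\rangle$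 is smooth, and if $v_j\in T_{x_j'}\widetilde M$ satisfy $\sum_j\Gamma_j\,df_{x_j'}(v_j)=0$ for all twisted test functions $f$, then $v_1=\dots=v_N=0$. 4. $P$ is equivariant, $\phi^*P(x_1',\dots,x_N')=P(\widetilde\phi^{-1}(x_1'),\dots,\widetilde\phi^{-1}(x_N'))$ for $\phi\in\mathrm{SDiff}(M)$, and $\mathrm{SDiff}(M)$ acts transitively on $\widetilde M^N\setminus\widetilde\Delta$ through the lifts. -/

import Mathlib

open scoped Manifold ContDiff Topology
open Set
noncomputable section
set_option linter.unusedSectionVars false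
set_option linter.unusedVariables false

namespace PointVortex

abbrev Plane : Type := EuclideanSpace ℝ (Fin 2)

section Carries
variable {V W X : Type*} [AddCommGroup V] [Module ℝ V] [AddCommGroup W] [Module ℝ W]
  [AddCommGroup X] [Module ℝ X]

/-- The linear map `A` is invertible and transports the orientation `o` to the orientation `o'`. -/
def Carries (A : V →ₗ[ℝ] W) (o : Orientation ℝ V (Fin 2)) (o' : Orientation ℝ W (Fin 2)) : Prop :=
  ∃ B : V ≃ₗ[ℝ] W, (B : V →ₗ[ℝ] W) = A ∧ Orientation.map (Fin 2) B o = o'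

theorem map_map_orientation (B : V ≃ₗ[ℝ] W) (C : W ≃ₗ[ℝ] X) (o : Orientation ℝ V (Fin 2)) :
    Orientation.map (Fin 2) C (Orientation.map (Fin 2) B o) =
      Orientation.map (Fin 2) (B.trans C) o := by
  induction o using Module.Ray.ind with
  | h v hv => rfl

theorem carries_equiv (B : V ≃ₗ[ℝ] W) (o : Orientation ℝ V (Fin 2)) :
    Carries (B : V →ₗ[ℝ] W) o (Orientation.map (Fin 2) B o) := ⟨B, rfl, rfl⟩

theorem Carries.comp {A : V →ₗ[ℝ] W} {A' : W →ₗ[ℝ] X} {o : Orientation ℝ V (Fin 2)}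
    {o' : Orientation ℝ W (Fin 2)} {o'' : Orientation ℝ X (Fin 2)}
    (h' : Carries A' o' o'') (h : Carries A o o') : Carries (A' ∘ₗ A) o o'' := by
  obtain ⟨B, rfl, rfl⟩ := h
  obtain ⟨C, rfl, rfl⟩ := h'
  exact ⟨B.trans C, rfl, (map_map_orientation B C o).symm⟩

theorem Carries.unique {A : V →ₗ[ℝ] W} {o : Orientation ℝ V (Fin 2)}
    {o₁ o₂ : Orientation ℝ W (Fin 2)} (h₁ : Carries A o o₁) (h₂ : Carries A o o₂) : o₁ = o₂ := by
  obtain ⟨B, hB, rfl⟩ := h₁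
  obtain ⟨C, hC, rfl⟩ := h₂
  have : B = C := LinearEquiv.toLinearMap_injective (hB.trans hC.symm)
  rw [this]

theorem Carries.unique_left {A : V →ₗ[ℝ] W} {o₁ o₂ : Orientation ℝ V (Fin 2)}
    {o : Orientation ℝ W (Fin 2)} (h₁ : Carries A o₁ o) (h₂ : Carries A o₂ o) : o₁ = o₂ := by
  obtain ⟨B, hB, hB'⟩ := h₁
  obtain ⟨C, hC, hC'⟩ := h₂
  have : B = C := LinearEquiv.toLinearMap_injective (hB.trans hC.symm)
  subst this
  exact (Orientation.map (Fin 2) B).injective (hB'.trans hC'.symm)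

theorem Carries.neg {A : V →ₗ[ℝ] W} {o : Orientation ℝ V (Fin 2)}
    {o' : Orientation ℝ W (Fin 2)} (h : Carries A o o') : Carries A (-o) (-o') := by
  obtain ⟨B, rfl, rfl⟩ := h
  exact ⟨B, rfl, Orientation.map_neg B o⟩

theorem Carries.symm {A : V →ₗ[ℝ] W} {A' : W →ₗ[ℝ] V} {o : Orientation ℝ V (Fin 2)}
    {o' : Orientation ℝ W (Fin 2)} (h : Carries A o o') (hA : A ∘ₗ A' = LinearMap.id) :
    Carries A' o' o := by
  obtain ⟨B, rfl, rfl⟩ := h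
  refine ⟨B.symm, ?_, (Orientation.map (Fin 2) B).symm_apply_apply o⟩
  ext1 v
  apply B.injective
  exact (B.apply_symm_apply v).trans (LinearMap.congr_fun hA v).symm

theorem carries_id (o : Orientation ℝ V (Fin 2)) : Carries LinearMap.id o o :=
  ⟨LinearEquiv.refl ℝ V, rfl, by simp⟩

end Carries

theorem isOpen_carries (o o' : Orientation ℝ Plane (Fin 2)) :
    IsOpen {A : Plane →L[ℝ] Plane | Carries (A : Plane →ₗ[ℝ] Plane) o o'} := by
  have hc : Continuous fun A : Plane →L[ℝ] Plane => LinearMap.det (A : Plane →ₗ[ℝ] Plane) := by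
    have := ContinuousLinearMap.continuous_det (𝕜 := ℝ) (E := Plane)
    exact this
  rw [isOpen_iff_forall_mem_open]
  rintro A ⟨B, hB, hB'⟩
  have key : ∀ A' : Plane →L[ℝ] Plane,
      0 < LinearMap.det (B.symm : Plane →ₗ[ℝ] Plane) * LinearMap.det (A' : Plane →ₗ[ℝ] Plane) →
      Carries (A' : Plane →ₗ[ℝ] Plane) o o' := by
    intro A' hA'
    have hne : LinearMap.det ((B.symm : Plane →ₗ[ℝ] Plane) ∘ₗ (A' : Plane →ₗ[ℝ] Plane)) ≠ 0 := by
      rw [LinearMap.det_comp]; exact hA'.ne'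
    let D := LinearMap.equivOfDetNeZero _ hne
    have hD : Orientation.map (Fin 2) D o = o := by
      rw [Orientation.map_eq_iff_det_pos _ _ (by simp)]
      change 0 < LinearMap.det ((B.symm : Plane →ₗ[ℝ] Plane) ∘ₗ (A' : Plane →ₗ[ℝ] Plane))
      rw [LinearMap.det_comp]; exact hA'
    refine ⟨D.trans B, ?_, ?_⟩
    · ext1 v
      change B (B.symm (A' v)) = A' v
      simp
    · rw [← map_map_orientation, hD, hB']
  refine ⟨{A' | 0 < LinearMap.det (B.symm : Plane →ₗ[ℝ] Plane) *
    LinearMap.det (A' : Plane →ₗ[ℝ] Plane)}, key, ?_, ?_⟩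
  · exact isOpen_lt continuous_const (continuous_const.mul hc)
  · change 0 < LinearMap.det (B.symm : Plane →ₗ[ℝ] Plane) * LinearMap.det (A : Plane →ₗ[ℝ] Plane)
    rw [← hB, ← LinearMap.det_comp]
    simp

variable {M : Type*} [TopologicalSpace M] [ChartedSpace Plane M]

section ChartRep

/-- The domain of the expression of `φ` in the charts `e` and `e'`. -/
def repDomain (φ : M → M) (e e' : OpenPartialHomeomorph M Plane) : Set Plane :=
  e.target ∩ {y | φ (e.symm y) ∈ e'.source}

theorem isOpen_repDomain {φ : M → M} (hφ : Continuous φ) (e e' : OpenPartialHomeomorph M Plane) :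
    IsOpen (repDomain φ e e') :=
  (hφ.comp_continuousOn e.continuousOn_symm).isOpen_inter_preimage e.open_target e'.open_source

theorem contDiffOn_rep [IsManifold (𝓡 2) ∞ M] {φ : M → M} (hφ : ContMDiff (𝓡 2) (𝓡 2) ∞ φ)
    {e e' : OpenPartialHomeomorph M Plane} (he : e ∈ atlas Plane M) (he' : e' ∈ atlas Plane M) :
    ContDiffOn ℝ ∞ (e' ∘ φ ∘ e.symm) (repDomain φ e e') := by
  rw [← contMDiffOn_iff_contDiffOn]
  have h1 : ContMDiffOn (𝓡 2) (𝓡 2) ∞ e' e'.source :=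
    contMDiffOn_of_mem_maximalAtlas (IsManifold.subset_maximalAtlas he')
  have h2 : ContMDiffOn (𝓡 2) (𝓡 2) ∞ e.symm e.target :=
    contMDiffOn_symm_of_mem_maximalAtlas (IsManifold.subset_maximalAtlas he)
  exact h1.comp (hφ.comp_contMDiffOn (h2.mono inter_subset_left)) (fun y hy => hy.2)

theorem fderiv_rep [IsManifold (𝓡 2) ∞ M] {φ : M → M} (hφ : ContMDiff (𝓡 2) (𝓡 2) ∞ φ)
    {e e' : OpenPartialHomeomorph M Plane} (he : e ∈ atlas Plane M) (he' : e' ∈ atlas Plane M)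
    {y : Plane} (hy : y ∈ repDomain φ e e') :
    fderiv ℝ (e' ∘ φ ∘ e.symm) y = (mfderiv (𝓡 2) (𝓡 2) e' (φ (e.symm y))).comp
      ((mfderiv (𝓡 2) (𝓡 2) φ (e.symm y)).comp (mfderiv (𝓡 2) (𝓡 2) e.symm y)) := by
  have h1 : MDifferentiableAt (𝓡 2) (𝓡 2) e' (φ (e.symm y)) := mdifferentiableAt_atlas he' hy.2
  have h2 : MDifferentiableAt (𝓡 2) (𝓡 2) e.symm y := mdifferentiableAt_atlas_symm he hy.1
  have h3 : MDifferentiableAt (𝓡 2) (𝓡 2) φ (e.symm y) := hφ.mdifferentiableAt (by simp)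
  rw [← mfderiv_eq_fderiv]
  have h4 := mfderiv_comp y (h3) h2
  have h5 := mfderiv_comp (g := e') (f := φ ∘ e.symm) y h1 (h3.comp y h2)
  rw [h4] at h5
  exact h5

theorem isOpen_rep_carries [IsManifold (𝓡 2) ∞ M] {φ : M → M}
    (hφ : ContMDiff (𝓡 2) (𝓡 2) ∞ φ) {e e' : OpenPartialHomeomorph M Plane}
    (he : e ∈ atlas Plane M) (he' : e' ∈ atlas Plane M) (o o' : Orientation ℝ Plane (Fin 2)) :
    IsOpen {y | y ∈ repDomain φ e e' ∧
      Carries (fderiv ℝ (e' ∘ φ ∘ e.symm) y : Plane →ₗ[ℝ] Plane) o o'} := by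
  have h := (contDiffOn_rep hφ he he').continuousOn_fderiv_of_isOpen
    (isOpen_repDomain hφ.continuous e e') (by simp)
  exact h.isOpen_inter_preimage (isOpen_repDomain hφ.continuous e e') (isOpen_carries o o')

end ChartRep

variable (M) in
/-- The total space of the orientation double cover: the points of this type are pairs consisting
of a point of the surface and an orientation of the tangent plane there. -/
structure OrientationCover where
  /-- the projection to the surface -/
  pt : M
  /-- the chosen orientation of the tangent plane -/
  orient : Orientation ℝ (TangentSpace (𝓡 2) pt) (Fin 2)

namespace OrientationCover

theorem ext_plane {x y : OrientationCover M} (h : x.pt = y.pt)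
    (h' : (x.orient : Orientation ℝ Plane (Fin 2)) = y.orient) : x = y := by
  obtain ⟨p, o⟩ := x
  obtain ⟨q, o'⟩ := y
  obtain rfl : p = q := h
  obtain rfl : o = o' := h'
  rfl

/-- The deck transformation: it reverses the orientation. -/
def flip (x : OrientationCover M) : OrientationCover M := ⟨x.pt, -x.orient⟩

theorem orient_eq_of_carries {e : OpenPartialHomeomorph M Plane} {o : Orientation ℝ Plane (Fin 2)}
    {x x' : OrientationCover M} (h : x.pt = x'.pt)
    (hx : Carries (W := Plane) (mfderiv (𝓡 2) (𝓡 2) e x.pt).toLinearMap x.orient o)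
    (hx' : Carries (W := Plane) (mfderiv (𝓡 2) (𝓡 2) e x'.pt).toLinearMap x'.orient o) :
    x = x' := by
  obtain ⟨p, q⟩ := x
  obtain ⟨p', q'⟩ := x'
  obtain rfl : p = p' := h
  obtain rfl := hx.unique_left hx'
  rfl

variable [IsManifold (𝓡 2) ∞ M]

/-- The orientation at `e.symm y` which the derivative of the chart `e` carries to `o`
(meaningful for `y ∈ e.target`). -/
def pullOrient (e : OpenPartialHomeomorph M Plane) (o : Orientation ℝ Plane (Fin 2)) (y : Plane) :
    Orientation ℝ (TangentSpace (𝓡 2) (e.symm y)) (Fin 2) :=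
  Classical.epsilon (h := ⟨(o : Orientation ℝ Plane (Fin 2))⟩) fun q =>
    Carries (W := Plane) (mfderiv (𝓡 2) (𝓡 2) e (e.symm y)).toLinearMap q o

theorem exists_carries_chart {e : OpenPartialHomeomorph M Plane} (he : e ∈ atlas Plane M)
    {p : M} (hp : p ∈ e.source) (o : Orientation ℝ Plane (Fin 2)) :
    ∃ q, Carries (W := Plane) (mfderiv (𝓡 2) (𝓡 2) e p).toLinearMap q o := by
  let B : TangentSpace (𝓡 2) p ≃ₗ[ℝ] Plane :=
    ((mdifferentiable_of_mem_atlas (I := 𝓡 2) he).mfderiv hp).toLinearEquiv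
  exact ⟨(Orientation.map (Fin 2) B).symm o, B, rfl,
    (Orientation.map (Fin 2) B).apply_symm_apply o⟩

theorem pullOrient_spec {e : OpenPartialHomeomorph M Plane} (he : e ∈ atlas Plane M)
    {y : Plane} (hy : y ∈ e.target) (o : Orientation ℝ Plane (Fin 2)) :
    Carries (W := Plane) (mfderiv (𝓡 2) (𝓡 2) e (e.symm y)).toLinearMap (pullOrient e o y) o :=
  Classical.epsilon_spec (exists_carries_chart he (e.map_target hy) o)

/-- The chart of the orientation cover given by a chart `e` of the surface and an orientation `o`
of the model plane: it is `e ∘ pt` on the set of all oriented points over the domain of `e` whose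
orientation is carried to `o` by the derivative of `e`. -/
def sheet (e : OpenPartialHomeomorph M Plane) (he : e ∈ atlas Plane M)
    (o : Orientation ℝ Plane (Fin 2)) : PartialEquiv (OrientationCover M) Plane where
  toFun x := e x.pt
  invFun y := ⟨e.symm y, pullOrient e o y⟩
  source := {x | x.pt ∈ e.source ∧
    Carries (W := Plane) (mfderiv (𝓡 2) (𝓡 2) e x.pt).toLinearMap x.orient o}
  target := e.target
  map_source' x hx := e.map_source hx.1
  map_target' y hy := ⟨e.map_target hy, pullOrient_spec he hy o⟩
  left_inv' x hx := orient_eq_of_carries (e.left_inv hx.1)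
    (pullOrient_spec he (e.map_source hx.1) o) hx.2
  right_inv' y hy := e.right_inv hy

theorem exists_carries (x : OrientationCover M) {e : OpenPartialHomeomorph M Plane}
    (he : e ∈ atlas Plane M) (hx : x.pt ∈ e.source) :
    ∃ o, Carries (W := Plane) (mfderiv (𝓡 2) (𝓡 2) e x.pt).toLinearMap x.orient o := by
  let B : TangentSpace (𝓡 2) x.pt ≃ₗ[ℝ] Plane :=
    ((mdifferentiable_of_mem_atlas (I := 𝓡 2) he).mfderiv hx).toLinearEquiv
  exact ⟨Orientation.map (Fin 2) B x.orient, carries_equiv B _⟩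

theorem carries_symm_chart {e : OpenPartialHomeomorph M Plane} (he : e ∈ atlas Plane M)
    {y : Plane} (hy : y ∈ e.target) (o : Orientation ℝ Plane (Fin 2)) :
    Carries (V := Plane) (W := TangentSpace (𝓡 2) (e.symm y))
      (mfderiv (𝓡 2) (𝓡 2) e.symm y).toLinearMap o (pullOrient e o y) := by
  refine (pullOrient_spec he hy o).symm ?_
  have h := (mdifferentiable_of_mem_atlas (I := 𝓡 2) he).comp_symm_deriv hy
  exact congrArg (fun A : Plane →L[ℝ] Plane => A.toLinearMap) h

/-- In charts, transport of orientations by `φ` is transport by the derivative of the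
coordinate expression of `φ`. -/
theorem rep_carries_iff {φ : M → M} (hφ : ContMDiff (𝓡 2) (𝓡 2) ∞ φ)
    {e e' : OpenPartialHomeomorph M Plane} (he : e ∈ atlas Plane M) (he' : e' ∈ atlas Plane M)
    {y : Plane} (hy : y ∈ repDomain φ e e') (o o' : Orientation ℝ Plane (Fin 2))
    (q : Orientation ℝ (TangentSpace (𝓡 2) (φ (e.symm y))) (Fin 2))
    (hq : Carries (W := TangentSpace (𝓡 2) (φ (e.symm y)))
      (mfderiv (𝓡 2) (𝓡 2) φ (e.symm y)).toLinearMap (pullOrient e o y) q) :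
    Carries (fderiv ℝ (e' ∘ φ ∘ e.symm) y).toLinearMap o o' ↔
      Carries (W := Plane) (mfderiv (𝓡 2) (𝓡 2) e' (φ (e.symm y))).toLinearMap q o' := by
  have h1 := hq.comp (carries_symm_chart he hy.1 o)
  have h2 : (fderiv ℝ (e' ∘ φ ∘ e.symm) y).toLinearMap =
    LinearMap.comp (M₁ := Plane) (M₃ := Plane)
      (mfderiv (𝓡 2) (𝓡 2) e' (φ (e.symm y))).toLinearMap
      (LinearMap.comp (mfderiv (𝓡 2) (𝓡 2) φ (e.symm y)).toLinearMap
        (mfderiv (𝓡 2) (𝓡 2) e.symm y).toLinearMap) := by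
    rw [fderiv_rep hφ he he' hy]; rfl
  rw [h2]
  constructor
  · intro h
    obtain ⟨o'', ho''⟩ := exists_carries ⟨φ (e.symm y), q⟩ he' hy.2
    have := (ho''.comp h1).unique h
    rwa [this] at ho''
  · intro h
    exact h.comp h1

theorem carries_mfderiv_id (p : M) (q : Orientation ℝ (TangentSpace (𝓡 2) p) (Fin 2)) :
    Carries (W := TangentSpace (𝓡 2) p) (mfderiv (𝓡 2) (𝓡 2) (id : M → M) p).toLinearMap q q := by
  rw [mfderiv_id]
  exact carries_id q

theorem sheet_trans_source {e e' : OpenPartialHomeomorph M Plane} (he : e ∈ atlas Plane M)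
    (he' : e' ∈ atlas Plane M) (o o' : Orientation ℝ Plane (Fin 2)) :
    ((sheet e he o).symm.trans (sheet e' he' o')).source =
      {y | y ∈ repDomain id e e' ∧ Carries (fderiv ℝ (e' ∘ id ∘ e.symm) y).toLinearMap o o'} := by
  ext y
  constructor
  · rintro ⟨h1, h2, h3⟩
    have hy : y ∈ repDomain id e e' := ⟨h1, h2⟩
    exact ⟨hy, (rep_carries_iff contMDiff_id he he' hy o o' _ (carries_mfderiv_id _ _)).2 h3⟩
  · rintro ⟨hy, h3⟩
    exact ⟨hy.1, hy.2,
      (rep_carries_iff contMDiff_id he he' hy o o' _ (carries_mfderiv_id _ _)).1 h3⟩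

theorem contDiffOn_sheet_trans {e e' : OpenPartialHomeomorph M Plane} (he : e ∈ atlas Plane M)
    (he' : e' ∈ atlas Plane M) (o o' : Orientation ℝ Plane (Fin 2)) :
    ContDiffOn ℝ ∞ ((sheet e he o).symm.trans (sheet e' he' o'))
      ((sheet e he o).symm.trans (sheet e' he' o')).source := by
  have h := contDiffOn_rep (M := M) contMDiff_id he he'
  refine h.mono ?_
  rw [sheet_trans_source]
  exact fun y hy => hy.1

variable (M) in
/-- The atlas of the orientation cover, consisting of all sheets over charts of the surface. -/
def chartedSpaceCore : ChartedSpaceCore Plane (OrientationCover M) where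
  atlas := {s | ∃ (e : OpenPartialHomeomorph M Plane) (he : e ∈ atlas Plane M)
    (o : Orientation ℝ Plane (Fin 2)), s = sheet e he o}
  chartAt x := sheet (chartAt Plane x.pt) (chart_mem_atlas Plane x.pt)
    (exists_carries x (chart_mem_atlas Plane x.pt) (mem_chart_source Plane x.pt)).choose
  mem_chart_source x := ⟨mem_chart_source Plane x.pt,
    (exists_carries x (chart_mem_atlas Plane x.pt) (mem_chart_source Plane x.pt)).choose_spec⟩
  chart_mem_atlas x := ⟨_, _, _, rfl⟩
  open_source := by
    rintro _ _ ⟨e, he, o, rfl⟩ ⟨e', he', o', rfl⟩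
    rw [sheet_trans_source]
    exact isOpen_rep_carries contMDiff_id he he' o o'
  continuousOn_toFun := by
    rintro _ _ ⟨e, he, o, rfl⟩ ⟨e', he', o', rfl⟩
    exact (contDiffOn_sheet_trans he he' o o').continuousOn

instance : TopologicalSpace (OrientationCover M) := (chartedSpaceCore M).toTopologicalSpace

instance : ChartedSpace Plane (OrientationCover M) := (chartedSpaceCore M).toChartedSpace

/-- A sheet as an open partial homeomorphism. -/
def sheetHomeo (e : OpenPartialHomeomorph M Plane) (he : e ∈ atlas Plane M)
    (o : Orientation ℝ Plane (Fin 2)) : OpenPartialHomeomorph (OrientationCover M) Plane :=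
  (chartedSpaceCore M).openPartialHomeomorph (sheet e he o) ⟨e, he, o, rfl⟩

theorem sheetHomeo_mem_atlas (e : OpenPartialHomeomorph M Plane) (he : e ∈ atlas Plane M)
    (o : Orientation ℝ Plane (Fin 2)) : sheetHomeo e he o ∈ atlas Plane (OrientationCover M) := by
  change _ ∈ ⋃ (e : PartialEquiv _ Plane) (he : e ∈ (chartedSpaceCore M).atlas),
    {(chartedSpaceCore M).openPartialHomeomorph e he}
  simp only [mem_iUnion, mem_singleton_iff]
  exact ⟨_, ⟨e, he, o, rfl⟩, rfl⟩

theorem mem_atlas_iff (s : OpenPartialHomeomorph (OrientationCover M) Plane) :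
    s ∈ atlas Plane (OrientationCover M) ↔ ∃ (e : OpenPartialHomeomorph M Plane)
      (he : e ∈ atlas Plane M) (o : Orientation ℝ Plane (Fin 2)), s = sheetHomeo e he o := by
  constructor
  · intro h
    change _ ∈ ⋃ (e : PartialEquiv _ Plane) (he : e ∈ (chartedSpaceCore M).atlas),
      {(chartedSpaceCore M).openPartialHomeomorph e he} at h
    simp only [mem_iUnion, mem_singleton_iff] at h
    obtain ⟨_, ⟨e, he, o, rfl⟩, rfl⟩ := h
    exact ⟨e, he, o, rfl⟩
  · rintro ⟨e, he, o, rfl⟩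
    exact sheetHomeo_mem_atlas e he o

instance : IsManifold (𝓡 2) ∞ (OrientationCover M) := by
  refine isManifold_of_contDiffOn _ _ _ ?_
  intro s s' hs hs'
  obtain ⟨e, he, o, rfl⟩ := (mem_atlas_iff s).1 hs
  obtain ⟨e', he', o', rfl⟩ := (mem_atlas_iff s').1 hs'
  have h := contDiffOn_sheet_trans he he' o o'
  refine h.mono ?_
  rintro y ⟨hy, -⟩
  exact hy

/-- The lift to the orientation cover of a diffeomorphism of the surface: an oriented point
`(p, o)` goes to `φ p` with the orientation transported by the derivative of `φ` at `p`. -/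
def lift (φ : M ≃ₘ^∞⟮𝓡 2, 𝓡 2⟯ M) (x : OrientationCover M) : OrientationCover M :=
  ⟨φ x.pt, Orientation.map (Fin 2)
    (φ.mfderivToContinuousLinearEquiv (by simp) x.pt).toLinearEquiv x.orient⟩

theorem lift_carries (φ : M ≃ₘ^∞⟮𝓡 2, 𝓡 2⟯ M) (x : OrientationCover M) :
    Carries (W := TangentSpace (𝓡 2) (φ x.pt)) (mfderiv (𝓡 2) (𝓡 2) φ x.pt).toLinearMap
      x.orient (lift φ x).orient :=
  carries_equiv (φ.mfderivToContinuousLinearEquiv (by simp) x.pt).toLinearEquiv x.orient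

theorem lift_flip (φ : M ≃ₘ^∞⟮𝓡 2, 𝓡 2⟯ M) (x : OrientationCover M) :
    lift φ (flip x) = flip (lift φ x) := by
  unfold lift flip
  simp only [Orientation.map_neg]

theorem lift_symm_lift (φ : M ≃ₘ^∞⟮𝓡 2, 𝓡 2⟯ M) (x : OrientationCover M) :
    lift φ.symm (lift φ x) = x := by
  refine ext_plane (φ.symm_apply_apply x.pt) ?_
  have h := (lift_carries φ.symm (lift φ x)).comp (lift_carries φ x)
  have h1 : MDifferentiableAt (𝓡 2) (𝓡 2) φ.symm (φ x.pt) := φ.symm.mdifferentiable (by simp) _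
  have h2 : MDifferentiableAt (𝓡 2) (𝓡 2) φ x.pt := φ.mdifferentiable (by simp) _
  have h3 := mfderiv_comp x.pt h1 h2
  have h4 : (φ.symm ∘ φ) = (id : M → M) := funext φ.symm_apply_apply
  rw [h4, mfderiv_id] at h3
  have h5 : (LinearMap.comp (mfderiv (𝓡 2) (𝓡 2) φ.symm (lift φ x).pt).toLinearMap
      (mfderiv (𝓡 2) (𝓡 2) φ x.pt).toLinearMap : Plane →ₗ[ℝ] Plane) = LinearMap.id :=
    congrArg (fun A : Plane →L[ℝ] Plane => A.toLinearMap) h3.symm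
  have h6 : Carries (LinearMap.id : Plane →ₗ[ℝ] Plane) x.orient
      (lift φ.symm (lift φ x)).orient := by
    rw [← h5]; exact h
  exact h6.unique (carries_id (V := Plane) x.orient)

theorem contMDiff_lift (φ : M ≃ₘ^∞⟮𝓡 2, 𝓡 2⟯ M) : ContMDiff (𝓡 2) (𝓡 2) ∞ (lift φ) := by
  intro x
  let e := chartAt Plane x.pt
  let e' := chartAt Plane (φ x.pt)
  have he : e ∈ atlas Plane M := chart_mem_atlas _ _
  have he' : e' ∈ atlas Plane M := chart_mem_atlas _ _
  obtain ⟨o, ho⟩ := exists_carries x he (mem_chart_source Plane x.pt)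
  obtain ⟨o', ho'⟩ := exists_carries (lift φ x) he' (mem_chart_source Plane (φ x.pt))
  let S := sheetHomeo e he o
  let S' := sheetHomeo e' he' o'
  have hxS : x ∈ S.source := ⟨mem_chart_source Plane x.pt, ho⟩
  have hinv : ∀ z ∈ S.source, S.symm (S z) = z := fun z hz => S.left_inv hz
  let W : Set Plane := {y | y ∈ repDomain φ e e' ∧
    Carries (fderiv ℝ (e' ∘ φ ∘ e.symm) y).toLinearMap o o'}
  have hW : IsOpen W := isOpen_rep_carries φ.contMDiff he he' o o'
  -- on the part of the sheet over `W`, the lift takes values in the sheet `S'`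
  have hmem : ∀ z ∈ S.source, S z ∈ repDomain φ e e' → (S z ∈ W ↔ lift φ z ∈ S'.source) := by
    intro z hz hzW
    have h1 := rep_carries_iff φ.contMDiff he he' hzW o o'
      (lift φ (S.symm (S z))).orient (lift_carries φ (S.symm (S z)))
    have h2 : lift φ (S.symm (S z)) ∈ S'.source ↔ lift φ z ∈ S'.source := by rw [hinv z hz]
    rw [← h2]
    exact ⟨fun h => ⟨hzW.2, h1.1 h.2⟩, fun h => ⟨hzW, h1.2 h.2⟩⟩
  have hxD : S x ∈ repDomain φ e e' := by
    refine ⟨S.map_source hxS, ?_⟩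
    change φ (e.symm (e x.pt)) ∈ e'.source
    rw [e.left_inv (mem_chart_source Plane x.pt)]
    exact mem_chart_source Plane _
  have hxW : S x ∈ W := (hmem x hxS hxD).2 ⟨mem_chart_source Plane (φ x.pt), ho'⟩
  have hS : ContMDiffAt (𝓡 2) (𝓡 2) ∞ S x := contMDiffAt_of_mem_maximalAtlas
    (IsManifold.subset_maximalAtlas (sheetHomeo_mem_atlas e he o)) hxS
  have hS' : ContMDiffOn (𝓡 2) (𝓡 2) ∞ S'.symm S'.target := contMDiffOn_symm_of_mem_maximalAtlas
    (IsManifold.subset_maximalAtlas (sheetHomeo_mem_atlas e' he' o'))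
  have hr : ContMDiffOn (𝓡 2) (𝓡 2) ∞ (e' ∘ φ ∘ e.symm) W :=
    ((contDiffOn_rep φ.contMDiff he he').mono fun y hy => hy.1).contMDiffOn
  have hr' : ContMDiffAt (𝓡 2) (𝓡 2) ∞ (S'.symm ∘ (e' ∘ φ ∘ e.symm)) (S x) := by
    refine (hS'.comp hr ?_).contMDiffAt (hW.mem_nhds hxW)
    intro y hy
    exact e'.map_source hy.1.2
  refine (hr'.comp x hS).congr_of_eventuallyEq ?_
  have hnear : ∀ᶠ z in 𝓝 x, z ∈ S.source ∧ S z ∈ W :=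
    (S.open_source.mem_nhds hxS |> Filter.eventually_mem_set.2).and
      (hS.continuousAt.eventually (hW.mem_nhds hxW |> Filter.eventually_mem_set.2))
  filter_upwards [hnear] with z hz
  have h3 := (hmem z hz.1 hz.2.1).1 hz.2
  have h4 : (e' ∘ φ ∘ e.symm) (S z) = S' (lift φ z) := by
    change e' (φ (e.symm (e z.pt))) = e' (φ z.pt)
    rw [e.left_inv hz.1.1]
  change lift φ z = S'.symm ((e' ∘ φ ∘ e.symm) (S z))
  rw [h4, S'.left_inv h3]

/-- The lift of a diffeomorphism as a homeomorphism of the orientation cover. -/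
def liftHomeo (φ : M ≃ₘ^∞⟮𝓡 2, 𝓡 2⟯ M) : OrientationCover M ≃ₜ OrientationCover M where
  toFun := lift φ
  invFun := lift φ.symm
  left_inv x := lift_symm_lift φ x
  right_inv x := lift_symm_lift φ.symm x
  continuous_toFun := (contMDiff_lift φ).continuous
  continuous_invFun := (contMDiff_lift φ.symm).continuous

end OrientationCover

open OrientationCover

variable [IsManifold (𝓡 2) ∞ M]

variable (M) in
/-- The surface is orientable if it admits a continuous choice of an orientation of its tangent
planes, that is, a continuous section of the orientation double cover. -/
def IsOrientable : Prop :=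
  ∃ s : M → OrientationCover M, Continuous s ∧ ∀ p, (s p).pt = p

/-- A smooth Riemannian metric on the surface. -/
abbrev Metric (M : Type*) [TopologicalSpace M] [ChartedSpace Plane M] [IsManifold (𝓡 2) ∞ M] :=
  Bundle.ContMDiffRiemannianMetric (𝓡 2) ∞ Plane (fun p : M => TangentSpace (𝓡 2) p)

/-- The Riemannian area element: the area of the parallelogram spanned by two tangent vectors.
It needs no orientation. -/
def areaElement (g : Metric M) (p : M) (u v : TangentSpace (𝓡 2) p) : ℝ :=
  √(g.inner p u u * g.inner p v v - g.inner p u v ^ 2)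

/-- The volume-preserving (that is, area-preserving) diffeomorphisms of the surface. -/
def SDiff (g : Metric M) : Set (M ≃ₘ^∞⟮𝓡 2, 𝓡 2⟯ M) :=
  {φ | ∀ (p : M) (u v : TangentSpace (𝓡 2) p),
    areaElement g (φ p) (mfderiv (𝓡 2) (𝓡 2) φ p u) (mfderiv (𝓡 2) (𝓡 2) φ p v) =
      areaElement g p u v}

variable (M) in
/-- The twisted test functions: smooth compactly supported functions on the orientation cover
which change sign when the orientation is reversed. -/
def TwistedTest : Submodule ℝ (OrientationCover M → ℝ) where
  carrier := {f | ContMDiff (𝓡 2) 𝓘(ℝ, ℝ) ∞ f ∧ HasCompactSupport f ∧ ∀ x, f (flip x) = -f x}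
  zero_mem' := ⟨contMDiff_const, HasCompactSupport.zero, fun x => by simp⟩
  add_mem' := fun {f f'} hf hf' => ⟨hf.1.add hf'.1, hf.2.1.add hf'.2.1, fun x => by
    simp only [Pi.add_apply, hf.2.2, hf'.2.2]; ring⟩
  smul_mem' := fun c f hf => ⟨(contMDiff_const (c := c)).mul (n := ∞) hf.1, hf.2.1.smul_left (f := fun _ => c),
    fun x => by simp [hf.2.2]⟩

/-- The derivative at `x` of a twisted test function in the direction of the tangent vector `v`. -/
def TwistedTest.dir (f : TwistedTest M) (x : OrientationCover M) (v : TangentSpace (𝓡 2) x) : ℝ :=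
  mfderiv (𝓡 2) 𝓘(ℝ, ℝ) f.1 x v

variable (M) in
/-- Distributional 2-forms on the surface. The product of a 2-form `ω` with a twisted function `f`
is a density, so 2-forms pair with twisted test functions by `f ↦ ∫ f ω`, and distributional
2-forms are linear functionals on them. -/
abbrev TwoCurrent : Type _ := Module.Dual ℝ (TwistedTest M)

/-- The weak topology: convergence of 2-currents is convergence on each twisted test function. -/
instance : TopologicalSpace (TwoCurrent M) :=
  TopologicalSpace.induced (fun T (f : TwistedTest M) => T f) inferInstance

/-- The twisted test function `(φ⁻¹)^* f`. -/
def pushTest (φ : M ≃ₘ^∞⟮𝓡 2, 𝓡 2⟯ M) : TwistedTest M →ₗ[ℝ] TwistedTest M where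
  toFun f := ⟨fun x => f.1 (lift φ.symm x), by
    refine ⟨f.2.1.comp (contMDiff_lift φ.symm),
    f.2.2.1.comp_homeomorph (liftHomeo φ.symm), fun x =>
      (congrArg f.1 (lift_flip φ.symm x)).trans (f.2.2.2 _)⟩⟩
  map_add' _ _ := rfl
  map_smul' _ _ := rfl

/-- The pull-back `φ^* T` of a 2-current, `⟨φ^* T, f⟩ = ⟨T, (φ⁻¹)^* f⟩`: for a 2-form `ω` one has
`∫ f φ^*ω = ∫ ((φ⁻¹)^* f) ω`. -/
def pullback (φ : M ≃ₘ^∞⟮𝓡 2, 𝓡 2⟯ M) (T : TwoCurrent M) : TwoCurrent M :=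
  LinearMap.comp (M₂ := TwistedTest M) T (pushTest φ)

/-- The orbit `{φ^* T | φ ∈ SDiff}` of a 2-current under the volume-preserving diffeomorphisms. -/
def coadjointOrbit (g : Metric M) (T : TwoCurrent M) : Set (TwoCurrent M) :=
  {S | ∃ φ ∈ SDiff g, S = pullback φ T}

/-- The delta function 2-form of a point vortex of strength one (with respect to the given
orientation) at an oriented point. Reversing the orientation reverses its sign. -/
def pointVortex (x : OrientationCover M) : TwoCurrent M :=
  (LinearMap.proj x).comp (TwistedTest M).subtype

/-- The vorticity 2-form of `N` point vortices: the `j`-th one is located at the point below `x j`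
and has strength `Γ j` with respect to the orientation given by `x j`. -/
def vorticity {N : ℕ} (Γ : Fin N → ℝ) (x : Fin N → OrientationCover M) : TwoCurrent M :=
  ∑ j, Γ j • pointVortex (x j)

variable (M) in
/-- The tuples of points of the orientation cover whose projections to the surface collide. -/
def collisionSet (N : ℕ) : Set (Fin N → OrientationCover M) :=
  {x | ∃ i j, i ≠ j ∧ (x i).pt = (x j).pt}

end PointVortex

end

/-! The geometric core is transitivity: area-preserving diffeomorphisms carry any collision-free
configuration of oriented points to any other (`exists_SDiff_lift_eq`). It gives that P lands in the
orbit. Surjectivity only needs that pulling back the vorticity of x amounts to moving the vortices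
by the inverse lift (`vorticity_eq_pullback`).

Transitivity starts from a local statement (`exists_local_move`). In a chart the area is a positive
density ρ; integrating ρ in one variable gives coordinates in which the density is constant
(`exists_chart_det_eq`). There a compactly supported twist, rotating each circle about a midpoint by
an angle depending on its radius, preserves area and moves a point to a prescribed nearby one.
Conjugated back and extended by the identity, it gives an area-preserving diffeomorphism supported
in a small open set. The orbits of one oriented point under the diffeomorphisms fixing a finite set
of oriented fibres are therefore open. The cover of a connected non-orientable surface is connected
(`preconnectedSpace_cover`) and stays connected after finitely many points are removed, so there is
only one orbit outside these fibres (`exists_move_fixing`). Vortices are then placed one at a time.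

The remaining claims come from localized twisted test functions (`exists_twistedTest`). Bumps around
the vortices of x detect, in any weakly close configuration y, exactly one vortex near each
position, together with its signed strength; so y is a relabelling of a configuration close to x
(`exists_nhds_relabel`). This gives openness, and, since the relabellings of y form a finite and
hence closed set, it also determines the fibres (`relabel_of_vorticity_eq`). Test functions that are
linear in a chart around a single vortex give the immersion property (`tangent_eq_zero`). -/

noncomputable section

namespace PointVortex

open OrientationCover

/-! ### Parameter integrals and area-preserving twists of the plane -/

section Plane

/-- The integral over `0 ≤ t ≤ 1` of a `C^n` function of `(t, x)` is a `C^n` function of `x`. -/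
theorem contDiff_intervalIntegral_param_nat.{u} {E : Type u} [NormedAddCommGroup E] [NormedSpace ℝ E]
    [ProperSpace E] (n : ℕ) : ∀ {G : Type u} [NormedAddCommGroup G] [NormedSpace ℝ G]
    {F : ℝ × E → G}, ContDiff ℝ n F → ContDiff ℝ n (fun x => ∫ t in (0 : ℝ)..1, F (t, x)) := by
  induction n with
  | zero =>
    intro G _ _ F hF
    have hF : Continuous F := hF.continuous
    refine contDiff_zero.2 ?_
    exact intervalIntegral.continuous_parametric_intervalIntegral_of_continuous'
      (f := fun x t => F (t, x)) (by fun_prop) 0 1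
  | succ n ih =>
    intro G _ _ F hF
    push_cast at hF ⊢
    have hc : Continuous F := hF.continuous
    have hd : Differentiable ℝ F := hF.differentiable (by simp)
    let D : ℝ × E → E →L[ℝ] G := fun p => (fderiv ℝ F p).comp (ContinuousLinearMap.inr ℝ ℝ E)
    have hD : ContDiff ℝ n D := (hF.fderiv_right le_rfl).clm_comp contDiff_const
    have hDc : Continuous D := hD.continuous
    -- The derivative is the integral of the partial derivative `D`, whose values are linear maps `E
    -- →L[ℝ] G`. Hence `G` varies in the induction and shares the universe of `E`. A bound for `D`
    -- on a compact set serves as the dominating constant.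
    refine contDiff_succ_iff_hasFDerivAt.2 ⟨_, ih hD, fun x₀ => ?_⟩
    obtain ⟨C, hC⟩ := ((isCompact_Icc (a := (0 : ℝ)) (b := 1)).prod
      (isCompact_closedBall x₀ 1)).exists_bound_of_continuousOn hDc.continuousOn
    refine intervalIntegral.hasFDerivAt_integral_of_dominated_of_fderiv_le
      (F := fun x t => F (t, x)) (F' := fun x t => D (t, x)) (bound := fun _ => C)
      (Metric.closedBall_mem_nhds x₀ one_pos) ?_ ?_ ?_ ?_ ?_ ?_
    · exact .of_forall fun x => (by fun_prop : Continuous fun t => F (t, x)).aestronglyMeasurable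
    · exact (by fun_prop : Continuous fun t => F (t, x₀)).intervalIntegrable _ _
    · exact (by fun_prop : Continuous fun t => D (t, x₀)).aestronglyMeasurable
    · refine .of_forall fun t ht x hx => hC (t, x) ⟨?_, hx⟩
      rw [uIoc_of_le zero_le_one] at ht
      exact Ioc_subset_Icc_self ht
    · exact intervalIntegrable_const
    · refine .of_forall fun t _ x _ => ?_
      exact (hd (t, x)).hasFDerivAt.comp x (hasFDerivAt_prodMk_right t x)

theorem contDiff_intervalIntegral_param.{u} {E G : Type u} [NormedAddCommGroup E] [NormedSpace ℝ E]
    [ProperSpace E] [NormedAddCommGroup G] [NormedSpace ℝ G] {F : ℝ × E → G}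
    (hF : ContDiff ℝ ∞ F) : ContDiff ℝ ∞ (fun x => ∫ t in (0 : ℝ)..1, F (t, x)) :=
  contDiff_infty.2 fun n => contDiff_intervalIntegral_param_nat n (contDiff_infty.1 hF n)

/-- The standard area form of the plane. -/
def cross (u v : Plane) : ℝ := u 0 * v 1 - u 1 * v 0

theorem plane_eq (v : Plane) :
    v = v 0 • EuclideanSpace.single 0 (1 : ℝ) + v 1 • EuclideanSpace.single 1 (1 : ℝ) := by
  ext i; fin_cases i <;> simp

theorem det_plane (A : Plane →ₗ[ℝ] Plane) : LinearMap.det A =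
    cross (A (EuclideanSpace.single 0 1)) (A (EuclideanSpace.single 1 1)) := by
  rw [← LinearMap.det_toMatrix (EuclideanSpace.basisFun (Fin 2) ℝ).toBasis, Matrix.det_fin_two]
  simp [LinearMap.toMatrix_apply, cross]
  ring

theorem cross_map (A : Plane →ₗ[ℝ] Plane) (u v : Plane) :
    cross (A u) (A v) = LinearMap.det A * cross u v := by
  rw [det_plane]
  conv_lhs => rw [plane_eq u, plane_eq v]
  simp only [map_add, map_smul, cross, PiLp.add_apply, PiLp.smul_apply, smul_eq_mul]
  ring

/-- The rotation of the plane by a quarter turn. -/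
def rotJ : Plane →L[ℝ] Plane := LinearMap.toContinuousLinearMap
  { toFun := fun v => !₂[-v 1, v 0]
    map_add' := fun u v => by ext i; fin_cases i <;> simp; ring
    map_smul' := fun c v => by ext i; fin_cases i <;> simp }

@[simp] theorem rotJ_zero (v : Plane) : rotJ v 0 = -v 1 := rfl
@[simp] theorem rotJ_one (v : Plane) : rotJ v 1 = v 0 := rfl

/-- The twist about `c`: the circle `‖z - c‖² = s` is rotated by the angle `θ s`. -/
def twist (c : Plane) (θ : ℝ → ℝ) (z : Plane) : Plane :=
  c + (Real.cos (θ (‖z - c‖ ^ 2)) • (z - c) + Real.sin (θ (‖z - c‖ ^ 2)) • rotJ (z - c))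

theorem plane_norm_sq (v : Plane) : ‖v‖ ^ 2 = v 0 ^ 2 + v 1 ^ 2 := by
  simp [EuclideanSpace.norm_sq_eq]

theorem norm_rot_sq (a : ℝ) (v : Plane) : ‖Real.cos a • v + Real.sin a • rotJ v‖ ^ 2 = ‖v‖ ^ 2 := by
  simp only [plane_norm_sq, PiLp.add_apply, PiLp.smul_apply, smul_eq_mul, rotJ_zero, rotJ_one]
  linear_combination (v 0 ^ 2 + v 1 ^ 2) * Real.sin_sq_add_cos_sq a

theorem contDiff_twist (c : Plane) {θ : ℝ → ℝ} (hθ : ContDiff ℝ ∞ θ) :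
    ContDiff ℝ ∞ (twist c θ) := by
  unfold twist
  have h : ContDiff ℝ ∞ fun z : Plane => θ (‖z - c‖ ^ 2) :=
    hθ.comp ((contDiff_id.sub contDiff_const).norm_sq ℝ)
  exact contDiff_const.add ((h.cos.smul (contDiff_id.sub contDiff_const)).add
    (h.sin.smul (rotJ.contDiff.comp (contDiff_id.sub contDiff_const))))

theorem norm_twist_sub (c : Plane) (θ : ℝ → ℝ) (z : Plane) : ‖twist c θ z - c‖ ^ 2 = ‖z - c‖ ^ 2 := by
  rw [twist, add_sub_cancel_left, norm_rot_sq]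

/-- A twist preserves the distance to `c`, so both twists use the same angle and the rotations
cancel. -/
theorem twist_neg_twist (c : Plane) (θ : ℝ → ℝ) (z : Plane) :
    twist c (fun s => -θ s) (twist c θ z) = z := by
  rw [twist, norm_twist_sub, twist, add_sub_cancel_left]
  set a := θ (‖z - c‖ ^ 2)
  rw [← eq_sub_iff_add_eq']
  have h := Real.sin_sq_add_cos_sq a
  ext i
  fin_cases i
  · simp
    linear_combination (z 0 - c 0) * h
  · simp
    linear_combination (z 1 - c 1) * h

theorem twist_of_zero {c : Plane} {θ : ℝ → ℝ} {z : Plane} (h : θ (‖z - c‖ ^ 2) = 0) :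
    twist c θ z = z := by
  simp [twist, h]

/-- A half turn about the midpoint of two points exchanges them; this is how twists move points. -/
theorem twist_of_pi {c : Plane} {θ : ℝ → ℝ} {z : Plane} (h : θ (‖z - c‖ ^ 2) = Real.pi) :
    twist c θ z = c - (z - c) := by
  simp [twist, h]; abel

/-- In polar coordinates about `c` the twist is a shear in the angle by a function of the radius,
which preserves r dr dα. The proof verifies this in Cartesian coordinates, with no exception at `c`.
-/
theorem det_fderiv_twist (c : Plane) {θ : ℝ → ℝ} (hθ : ContDiff ℝ ∞ θ) (z : Plane) :
    LinearMap.det (fderiv ℝ (twist c θ) z : Plane →ₗ[ℝ] Plane) = 1 := by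
  have h1 : HasFDerivAt (fun z : Plane => z - c) (ContinuousLinearMap.id ℝ Plane) z :=
    (hasFDerivAt_id z).sub_const c
  have h2 := h1.norm_sq
  have h3 := ((hθ.differentiable (by simp)) (‖z - c‖ ^ 2)).hasDerivAt.comp_hasFDerivAt z h2
  have h4 : HasFDerivAt (twist c θ) _ z :=
    ((h3.cos.smul h1).add (h3.sin.smul (rotJ.hasFDerivAt.comp z h1))).const_add c
  rw [h4.fderiv, det_plane]
  simp [cross, EuclideanSpace.inner_eq_star_dotProduct, dotProduct]
  set a := θ (‖z - c‖ ^ 2)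
  have h := Real.sin_sq_add_cos_sq a
  have hs : Real.sin a ^ 2 = 1 - Real.cos a ^ 2 := by linarith
  ring_nf
  grind

end Plane

/-! ### Extending compactly supported planar maps from a chart to the manifold -/

section Extension
variable {M : Type*} [TopologicalSpace M]

open Classical in
/-- The self-map of the plane `Φ`, read in the chart `e` and extended by the identity. -/
def extendChart (e : OpenPartialHomeomorph M Plane) (Φ : Plane → Plane) (p : M) : M :=
  if p ∈ e.source then e.symm (Φ (e p)) else p

variable {e : OpenPartialHomeomorph M Plane} {Φ : Plane → Plane} {K : Set Plane}

theorem extendChart_of_mem {p : M} (hp : p ∈ e.source) : extendChart e Φ p = e.symm (Φ (e p)) :=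
  if_pos hp

theorem extendChart_of_notMem (hΦ : ∀ y ∉ K, Φ y = y) {p : M} (hp : p ∉ e.symm '' K) :
    extendChart e Φ p = p := by
  by_cases h : p ∈ e.source
  · rw [extendChart_of_mem h, hΦ, e.left_inv h]
    exact fun hK => hp ⟨_, hK, e.left_inv h⟩
  · exact if_neg h

/-- If `Φ y` left `K` for some `y ∈ K`, it would be a fixed point, and injectivity would give `Φ y =
y ∈ K`. -/
theorem mapsTo_of_eq_off (hi : Function.Injective Φ) (hΦ : ∀ y ∉ K, Φ y = y) {T : Set Plane}
    (hK : K ⊆ T) {y : Plane} (hy : y ∈ T) : Φ y ∈ T := by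
  by_cases h : y ∈ K
  · refine hK ?_
    by_contra h'
    exact h' ((hi (hΦ _ h')).symm ▸ h)
  · rwa [hΦ y h]

theorem isCompact_symm_image (hK : IsCompact K) (hKe : K ⊆ e.target) : IsCompact (e.symm '' K) :=
  hK.image_of_continuousOn (e.continuousOn_symm.mono hKe)

variable [ChartedSpace Plane M]

/-- The image of `K` is compact, hence closed in the Hausdorff space `M`. So the chart domain and
the complement of this image form an open cover, and the map is smooth on both. -/
theorem contMDiff_extendChart [T2Space M]
    (he : ContMDiffOn (𝓡 2) (𝓡 2) ∞ e e.source) (he' : ContMDiffOn (𝓡 2) (𝓡 2) ∞ e.symm e.target)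
    (hs : ContDiff ℝ ∞ Φ) (hi : Function.Injective Φ) (hΦ : ∀ y ∉ K, Φ y = y)
    (hK : IsCompact K) (hKe : K ⊆ e.target) :
    ContMDiff (𝓡 2) (𝓡 2) ∞ (extendChart e Φ) := by
  intro p
  by_cases hp : p ∈ e.source
  · have h : ContMDiffOn (𝓡 2) (𝓡 2) ∞ (e.symm ∘ Φ ∘ e) e.source :=
      he'.comp (hs.contMDiff.comp_contMDiffOn he)
        fun q hq => mapsTo_of_eq_off hi hΦ hKe (e.map_source hq)
    refine (h.contMDiffAt (e.open_source.mem_nhds hp)).congr_of_eventuallyEq ?_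
    filter_upwards [e.open_source.mem_nhds hp] with q hq using extendChart_of_mem hq
  · have hp' : p ∉ e.symm '' K := by
      rintro ⟨y, hy, rfl⟩
      exact hp (e.map_target (hKe hy))
    refine contMDiffAt_id.congr_of_eventuallyEq ?_
    filter_upwards [(isCompact_symm_image hK hKe).isClosed.isOpen_compl.mem_nhds hp'] with q hq
    exact extendChart_of_notMem hΦ hq

theorem exists_diffeomorph_extendChart [T2Space M]
    (he : ContMDiffOn (𝓡 2) (𝓡 2) ∞ e e.source) (he' : ContMDiffOn (𝓡 2) (𝓡 2) ∞ e.symm e.target)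
    {Φ : Plane → Plane} {Φ' : Plane → Plane} (hs : ContDiff ℝ ∞ Φ) (hs' : ContDiff ℝ ∞ Φ')
    (hl : ∀ y, Φ' (Φ y) = y) (hr : ∀ y, Φ (Φ' y) = y)
    (hΦ : ∀ y ∉ K, Φ y = y) (hK : IsCompact K) (hKe : K ⊆ e.target) :
    ∃ φ : M ≃ₘ^∞⟮𝓡 2, 𝓡 2⟯ M, (∀ p ∈ e.source, φ p ∈ e.source ∧ φ p = e.symm (Φ (e p))) ∧
      ∀ p ∉ e.symm '' K, φ p = p := by
  have hi : Function.Injective Φ := Function.LeftInverse.injective hl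
  have hi' : Function.Injective Φ' := Function.LeftInverse.injective hr
  have hΦ' : ∀ y ∉ K, Φ' y = y := fun y hy => hi (by rw [hr, hΦ y hy])
  have key : ∀ {A B : Plane → Plane}, (∀ y, B (A y) = y) → (∀ y ∉ K, A y = y) → ∀ p : M,
      extendChart e B (extendChart e A p) = p := by
    intro A B hBA hA p
    by_cases hp : p ∈ e.source
    · have h1 : A (e p) ∈ e.target := mapsTo_of_eq_off
        (Function.LeftInverse.injective hBA) hA hKe (e.map_source hp)
      rw [extendChart_of_mem hp, extendChart_of_mem (e.map_target h1), e.right_inv h1, hBA,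
        e.left_inv hp]
    · simp [extendChart, hp]
  refine ⟨⟨⟨extendChart e Φ, extendChart e Φ', key hl hΦ, key hr hΦ'⟩,
    contMDiff_extendChart he he' hs hi hΦ hK hKe,
    contMDiff_extendChart he he' hs' hi' hΦ' hK hKe⟩, fun p hp => ?_, fun p hp => ?_⟩
  · change extendChart e Φ p ∈ _ ∧ extendChart e Φ p = _
    rw [extendChart_of_mem hp]
    exact ⟨e.map_target (mapsTo_of_eq_off hi hΦ hKe (e.map_source hp)), rfl⟩
  · exact extendChart_of_notMem hΦ hp

end Extension

/-! ### Local normal form of area densities and local planar moves -/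

section Darboux

/-- Multiplication by a bump function makes the density global, because the line integrals in
`primitive` may leave `U`. -/
theorem exists_contDiff_eventuallyEq {U : Set Plane} (hU : IsOpen U) {ρ : Plane → ℝ}
    (hρ : ContDiffOn ℝ ∞ ρ U) {y₀ : Plane} (hy₀ : y₀ ∈ U) :
    ∃ (σ : Plane → ℝ) (V : Set Plane), ContDiff ℝ ∞ σ ∧ IsOpen V ∧ V ⊆ U ∧ y₀ ∈ V ∧
      ∀ y ∈ V, σ y = ρ y := by
  obtain ⟨r, hr, hrU⟩ := Metric.isOpen_iff.1 hU y₀ hy₀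
  let χ : ContDiffBump y₀ := ⟨r / 4, r / 2, by positivity, by linarith⟩
  refine ⟨fun y => χ y * ρ y, Metric.ball y₀ (r / 4), ?_, Metric.isOpen_ball,
    (Metric.ball_subset_ball (by linarith)).trans hrU, Metric.mem_ball_self (by positivity), ?_⟩
  · refine contDiff_iff_contDiffAt.2 fun y => ?_
    by_cases hy : y ∈ U
    · exact χ.contDiff.contDiffAt.mul (hρ.contDiffAt (hU.mem_nhds hy))
    · have hy' : y ∉ tsupport χ := by
        rw [χ.tsupport_eq]
        exact fun h => hy (hrU (Metric.closedBall_subset_ball (by simp [χ]; linarith) h))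
      refine (contDiffAt_const (c := (0 : ℝ))).congr_of_eventuallyEq ?_
      filter_upwards [notMem_tsupport_iff_eventuallyEq.1 hy'] with z hz
      simp [hz]
  · intro y hy
    simp [χ.one_of_mem_closedBall (Metric.ball_subset_closedBall hy)]

/-- `∫ σ(s, y) ds` over `0 ≤ s ≤ x`, as a function of `(x, y)`. -/
def primitive (σ : Plane → ℝ) (z : Plane) : ℝ :=
  z 0 * ∫ t in (0 : ℝ)..1, σ (!₂[t * z 0, z 1])

theorem contDiff_coord (i : Fin 2) : ContDiff ℝ ∞ fun z : Plane => z i :=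
  (EuclideanSpace.proj (𝕜 := ℝ) i).contDiff

/-- The substitution `s = t * z 0` has moved the variable endpoint into the integrand, so smooth
dependence on parameters over a fixed interval suffices. -/
theorem contDiff_primitive {σ : Plane → ℝ} (hσ : ContDiff ℝ ∞ σ) : ContDiff ℝ ∞ (primitive σ) := by
  refine (contDiff_coord 0).mul (contDiff_intervalIntegral_param
    (F := fun p : ℝ × Plane => σ (!₂[p.1 * p.2 0, p.2 1])) (hσ.comp ?_))
  refine contDiff_euclidean.2 fun i => ?_
  fin_cases i
  · exact contDiff_fst.mul ((contDiff_coord 0).comp contDiff_snd)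
  · change ContDiff ℝ ∞ fun p : ℝ × Plane => p.2 1
    exact (contDiff_coord 1).comp contDiff_snd

theorem primitive_eq (σ : Plane → ℝ) (x y : ℝ) :
    primitive σ !₂[x, y] = ∫ s in (0 : ℝ)..x, σ !₂[s, y] := by
  have := intervalIntegral.smul_integral_comp_mul_right (fun s => σ !₂[s, y]) (a := 0) (b := 1) x
  simpa [primitive] using this

theorem fderiv_primitive {σ : Plane → ℝ} (hσ : ContDiff ℝ ∞ σ) (z : Plane) :
    fderiv ℝ (primitive σ) z (EuclideanSpace.single 0 1) = σ z := by
  have h1 : HasFDerivAt (primitive σ) _ z :=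
    ((contDiff_primitive hσ).differentiable (by simp) z).hasFDerivAt
  have hl : HasDerivAt (fun t : ℝ => z + (t - z 0) • (EuclideanSpace.single 0 1 : Plane))
      (EuclideanSpace.single 0 1) (z 0) := by
    simpa using (((hasDerivAt_id (z 0)).sub_const (z 0)).smul_const
      (EuclideanSpace.single 0 (1 : ℝ) : Plane)).const_add z
  have hz : ∀ t : ℝ, z + (t - z 0) • (EuclideanSpace.single 0 1 : Plane) = !₂[t, z 1] := by
    intro t; ext i; fin_cases i <;> simp
  have hz0 : !₂[z 0, z 1] = z := by ext i; fin_cases i <;> simp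
  simp only [hz] at hl
  rw [← hz0] at h1
  have h2 := h1.comp_hasDerivAt (z 0) hl
  rw [hz0] at h2
  have h3 : HasDerivAt (fun t => ∫ s in (0 : ℝ)..t, σ !₂[s, z 1]) (σ !₂[z 0, z 1]) (z 0) := by
    have hc : Continuous fun s : ℝ => σ !₂[s, z 1] := by
      have := hσ.continuous
      fun_prop
    exact intervalIntegral.integral_hasDerivAt_right (hc.intervalIntegrable _ _)
      (hc.stronglyMeasurableAtFilter _ _) hc.continuousAt
  rw [hz0] at h3
  refine h2.unique (h3.congr_of_eventuallyEq (.of_forall fun t => ?_))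
  exact primitive_eq σ t (z 1)

/-- Every smooth positive area density is locally the Jacobian determinant of a chart. -/
theorem exists_chart_det_eq {U : Set Plane} (hU : IsOpen U) {ρ : Plane → ℝ}
    (hρ : ContDiffOn ℝ ∞ ρ U) (hpos : ∀ y ∈ U, 0 < ρ y) {y₀ : Plane} (hy₀ : y₀ ∈ U) :
    ∃ Ψ : OpenPartialHomeomorph Plane Plane, y₀ ∈ Ψ.source ∧ Ψ.source ⊆ U ∧
      ContDiffOn ℝ ∞ Ψ Ψ.source ∧ ContDiffOn ℝ ∞ Ψ.symm Ψ.target ∧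
      ∀ y ∈ Ψ.source, LinearMap.det (fderiv ℝ Ψ y : Plane →ₗ[ℝ] Plane) = ρ y := by
  obtain ⟨σ, V, hσ, hV, hVU, hy₀V, hσV⟩ := exists_contDiff_eventuallyEq hU hρ hy₀
  -- The second coordinate is kept, so the Jacobian is triangular and its determinant is the first
  -- partial derivative of `primitive σ`, namely σ.
  let ψ : Plane → Plane := fun z => !₂[primitive σ z, z 1]
  have hψ : ContDiff ℝ ∞ ψ := by
    refine contDiff_euclidean.2 fun i => ?_
    fin_cases i
    · exact contDiff_primitive hσ
    · exact contDiff_coord 1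
  have hd : ∀ y, LinearMap.det (fderiv ℝ ψ y : Plane →ₗ[ℝ] Plane) = σ y := by
    intro y
    have hf := (hψ.differentiable (by simp) y).hasFDerivAt
    have h0 := (EuclideanSpace.proj (𝕜 := ℝ) (0 : Fin 2)).hasFDerivAt.comp y hf
    have h1 := (EuclideanSpace.proj (𝕜 := ℝ) (1 : Fin 2)).hasFDerivAt.comp y hf
    have e0 := h0.unique ((contDiff_primitive hσ).differentiable (by simp) y).hasFDerivAt
    have e1 := h1.unique (EuclideanSpace.proj (𝕜 := ℝ) (1 : Fin 2)).hasFDerivAt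
    have a0 := DFunLike.congr_fun e0 (EuclideanSpace.single 0 1)
    have a1 := DFunLike.congr_fun e1 (EuclideanSpace.single 0 1)
    have b1 := DFunLike.congr_fun e1 (EuclideanSpace.single 1 1)
    rw [fderiv_primitive hσ] at a0
    simp at a0 a1 b1
    rw [det_plane, cross]
    simp [a0, a1, b1]
  have hinv : ∀ y ∈ V, ∃ f' : Plane ≃L[ℝ] Plane, HasFDerivAt ψ (f' : Plane →L[ℝ] Plane) y := by
    intro y hy
    have hne : LinearMap.det (fderiv ℝ ψ y : Plane →ₗ[ℝ] Plane) ≠ 0 := by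
      rw [hd, hσV y hy]; exact (hpos y (hVU hy)).ne'
    refine ⟨(LinearMap.equivOfDetNeZero _ hne).toContinuousLinearEquiv, ?_⟩
    exact (hψ.differentiable (by simp) y).hasFDerivAt
  obtain ⟨f', hf'⟩ := hinv y₀ hy₀V
  let Ψ := (hψ.contDiffAt.toOpenPartialHomeomorph ψ hf' (by simp)).restrOpen V hV
  have hΨs : Ψ.source ⊆ V := inter_subset_right
  refine ⟨Ψ, ⟨hψ.contDiffAt.mem_toOpenPartialHomeomorph_source hf' (by simp), hy₀V⟩,
    hΨs.trans hVU, hψ.contDiffOn, ?_, fun y hy => ?_⟩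
  · intro y hy
    obtain ⟨f'', hf''⟩ := hinv (Ψ.symm y) (hΨs (Ψ.map_target hy))
    exact (Ψ.contDiffAt_symm hy hf'' hψ.contDiffAt).contDiffWithinAt
  · rw [← hσV y (hΨs hy), ← hd y]; rfl

/-- Conjugating a compactly supported unimodular map by a chart of Jacobian determinant `ρ` gives
a compactly supported map which preserves the density `ρ`. -/
theorem exists_conj_diffeomorph {ρ : Plane → ℝ} {Ψ : OpenPartialHomeomorph Plane Plane}
    (hpos : ∀ y ∈ Ψ.source, 0 < ρ y)
    (hΨ : ContDiffOn ℝ ∞ Ψ Ψ.source) (hΨ' : ContDiffOn ℝ ∞ Ψ.symm Ψ.target)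
    (hdet : ∀ y ∈ Ψ.source, LinearMap.det (fderiv ℝ Ψ y : Plane →ₗ[ℝ] Plane) = ρ y)
    {T T' : Plane → Plane} (hT : ContDiff ℝ ∞ T) (hT' : ContDiff ℝ ∞ T')
    (hl : ∀ y, T' (T y) = y) (hr : ∀ y, T (T' y) = y) {K₀ : Set Plane} (hK₀ : IsCompact K₀)
    (hK₀Ψ : K₀ ⊆ Ψ.target) (hTK : ∀ y ∉ K₀, T y = y)
    (hTdet : ∀ y, LinearMap.det (fderiv ℝ T y : Plane →ₗ[ℝ] Plane) = 1) :
    ∃ Φ : Plane ≃ₘ^∞⟮𝓡 2, 𝓡 2⟯ Plane, (∀ y ∉ Ψ.symm '' K₀, Φ y = y) ∧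
      (∀ y ∈ Ψ.source, Φ y = Ψ.symm (T (Ψ y))) ∧
      (∀ y, 0 < LinearMap.det (fderiv ℝ Φ y : Plane →ₗ[ℝ] Plane)) ∧
      ∀ y, ρ (Φ y) * LinearMap.det (fderiv ℝ Φ y : Plane →ₗ[ℝ] Plane) = ρ y := by
  have hKΨ : Ψ.symm '' K₀ ⊆ Ψ.source := by
    rintro _ ⟨y, hy, rfl⟩
    exact Ψ.map_target (hK₀Ψ hy)
  have hK := isCompact_symm_image hK₀ hK₀Ψ
  obtain ⟨Φ, hΦ, hΦK⟩ := exists_diffeomorph_extendChart (M := Plane) (e := Ψ) (K := K₀)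
    hΨ.contMDiffOn hΨ'.contMDiffOn hT hT' hl hr hTK hK₀ hK₀Ψ
  have hΦd : Differentiable ℝ Φ := Φ.contDiff.differentiable (by simp)
  have hin : ∀ y ∈ Ψ.source,
      ρ (Φ y) * LinearMap.det (fderiv ℝ Φ y : Plane →ₗ[ℝ] Plane) = ρ y := by
    intro y hy
    -- Taking determinants in this conjugation relation, with det DT = 1 and det DΨ = ρ, gives the
    -- invariance of ρ.
    have hnear : Ψ ∘ Φ =ᶠ[𝓝 y] T ∘ Ψ := by
      filter_upwards [Ψ.open_source.mem_nhds hy] with z hz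
      simp only [Function.comp_apply]
      rw [(hΦ z hz).2, Ψ.right_inv]
      exact mapsTo_of_eq_off (Function.LeftInverse.injective hl) hTK hK₀Ψ (Ψ.map_source hz)
    have hΨd : ∀ z ∈ Ψ.source, DifferentiableAt ℝ Ψ z := fun z hz =>
      (hΨ.contDiffAt (Ψ.open_source.mem_nhds hz)).differentiableAt (by simp)
    have h1 := hnear.fderiv_eq (𝕜 := ℝ)
    rw [fderiv_comp y (hΨd _ (hΦ y hy).1) (hΦd y),
      fderiv_comp y (hT.differentiable (by simp) _) (hΨd y hy)] at h1
    have h2 := congrArg (fun A : Plane →L[ℝ] Plane => LinearMap.det (A : Plane →ₗ[ℝ] Plane)) h1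
    change LinearMap.det (_ ∘ₗ _) = LinearMap.det (_ ∘ₗ _) at h2
    rw [LinearMap.det_comp, LinearMap.det_comp] at h2
    rwa [hTdet, one_mul, hdet _ (hΦ y hy).1, hdet y hy] at h2
  have hout : ∀ y ∉ Ψ.source, LinearMap.det (fderiv ℝ Φ y : Plane →ₗ[ℝ] Plane) = 1 := by
    intro y hy
    have hnear : Φ =ᶠ[𝓝 y] id := by
      filter_upwards [hK.isClosed.isOpen_compl.mem_nhds (fun h => hy (hKΨ h))] with z hz
      exact hΦK z hz
    rw [hnear.fderiv_eq, fderiv_id]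
    exact LinearMap.det_id
  refine ⟨Φ, hΦK, fun y hy => (hΦ y hy).2, fun y => ?_, fun y => ?_⟩
  · by_cases hy : y ∈ Ψ.source
    · have h1 := hpos y hy
      rw [← hin y hy] at h1
      exact (pos_iff_pos_of_mul_pos h1).1 (hpos _ (hΦ y hy).1)
    · rw [hout y hy]; exact one_pos
  · by_cases hy' : y ∈ Ψ.source
    · exact hin y hy'
    · rw [hout y hy', mul_one, hΦK y fun h => hy' (hKΨ h)]

/-- Points at distance less than `r` are exchanged by a twist supported at distance at most
`3 * r` from the first one. -/
theorem exists_twist (a b : Plane) {r : ℝ} (hr : 0 < r) (hab : ‖b - a‖ < r) :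
    ∃ (c : Plane) (θ : ℝ → ℝ), ContDiff ℝ ∞ θ ∧ twist c θ a = b ∧
      ∀ y ∉ Metric.closedBall a (3 * r), twist c θ y = y := by
  -- The angle is π for squared radius at most `r ^ 2` and 0 from `4 * r ^ 2` on. The centre is the
  -- midpoint, within `r` of `a`; hence a point farther than `3 * r` from `a` is farther than `2 *
  -- r` from the centre and stays fixed.
  let θ : ℝ → ℝ := fun s => Real.pi * Real.smoothTransition ((4 * r ^ 2 - s) / (3 * r ^ 2))
  have hθ : ContDiff ℝ ∞ θ := contDiff_const.mul (Real.smoothTransition.contDiff.comp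
    ((contDiff_const.sub contDiff_id).div_const _))
  let c : Plane := (2⁻¹ : ℝ) • (a + b)
  have hca : a - c = -(2⁻¹ : ℝ) • (b - a) := by simp only [c]; module
  have hca' : ‖a - c‖ ≤ r := by rw [hca, norm_smul]; norm_num; linarith
  refine ⟨c, θ, hθ, ?_, fun y hy => twist_of_zero ?_⟩
  · rw [twist_of_pi]
    · simp only [c]; module
    · simp only [θ]
      rw [Real.smoothTransition.one_of_one_le, mul_one]
      rw [one_le_div (by positivity)]
      nlinarith [norm_nonneg (a - c)]
  · have h1 : 3 * r < ‖y - a‖ := by simpa [dist_eq_norm] using hy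
    have h3 : ‖y - a‖ ≤ ‖y - c‖ + ‖a - c‖ := by
      have : y - a = (y - c) - (a - c) := by abel
      rw [this]; exact norm_sub_le _ _
    simp only [θ]
    rw [Real.smoothTransition.zero_of_nonpos, mul_zero]
    exact div_nonpos_of_nonpos_of_nonneg (by nlinarith) (by positivity)

/-- A smooth positive area density on an open set of the plane is preserved by diffeomorphisms
with compact support in this set which move a given point to any nearby point. -/
theorem exists_planar_diffeomorph {U : Set Plane} (hU : IsOpen U) {ρ : Plane → ℝ}
    (hρ : ContDiffOn ℝ ∞ ρ U) (hpos : ∀ y ∈ U, 0 < ρ y) {y₀ : Plane} (hy₀ : y₀ ∈ U) :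
    ∃ K ⊆ U, IsCompact K ∧ ∃ W ∈ 𝓝 y₀, ∀ w ∈ W, ∃ Φ : Plane ≃ₘ^∞⟮𝓡 2, 𝓡 2⟯ Plane,
      (∀ y ∉ K, Φ y = y) ∧ Φ y₀ = w ∧
      (∀ y, 0 < LinearMap.det (fderiv ℝ Φ y : Plane →ₗ[ℝ] Plane)) ∧
      ∀ y, ρ (Φ y) * LinearMap.det (fderiv ℝ Φ y : Plane →ₗ[ℝ] Plane) = ρ y := by
  obtain ⟨Ψ, hy₀Ψ, hΨU, hΨ, hΨ', hdet⟩ := exists_chart_det_eq hU hρ hpos hy₀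
  obtain ⟨R, hR, hRΨ⟩ := Metric.isOpen_iff.1 Ψ.open_target (Ψ y₀) (Ψ.map_source hy₀Ψ)
  obtain ⟨r, hr, hrR⟩ : ∃ r > 0, 3 * r < R := ⟨R / 4, by positivity, by linarith⟩
  have hK₀Ψ : Metric.closedBall (Ψ y₀) (3 * r) ⊆ Ψ.target :=
    (Metric.closedBall_subset_ball hrR).trans hRΨ
  have hK₀ := isCompact_closedBall (Ψ y₀) (3 * r)
  have hball : Ψ y₀ ∈ Metric.ball (Ψ y₀) r := Metric.mem_ball_self hr
  have hW : Ψ.source ∩ Ψ ⁻¹' Metric.ball (Ψ y₀) r ∈ 𝓝 y₀ :=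
    (Ψ.isOpen_inter_preimage Metric.isOpen_ball).mem_nhds ⟨hy₀Ψ, hball⟩
  have hKU : Ψ.symm '' Metric.closedBall (Ψ y₀) (3 * r) ⊆ U := by
    rintro _ ⟨y, hy, rfl⟩
    exact hΨU (Ψ.map_target (hK₀Ψ hy))
  refine ⟨_, hKU, isCompact_symm_image hK₀ hK₀Ψ, _, hW, fun w hw => ?_⟩
  have hwr : ‖Ψ w - Ψ y₀‖ < r := by
    rw [← dist_eq_norm]
    exact hw.2
  obtain ⟨c, θ, hθ, hab, hout⟩ := exists_twist (Ψ y₀) (Ψ w) hr hwr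
  obtain ⟨Φ, h1, h2, h3⟩ := exists_conj_diffeomorph (fun y hy => hpos y (hΨU hy)) hΨ hΨ' hdet
    (contDiff_twist c hθ) (contDiff_twist c hθ.neg)
    (twist_neg_twist c θ) (fun y => by simpa using twist_neg_twist c (fun s => -θ s) y)
    hK₀ hK₀Ψ hout (det_fderiv_twist c hθ)
  exact ⟨Φ, h1, by rw [h2 y₀ hy₀Ψ, hab, Ψ.left_inv hw.1], h3⟩

end Darboux

/-! ### Area-preserving diffeomorphisms supported in a chart -/

section AreaPreserving

/-- The pointwise hypothesis allows comparing derivatives whose tangent-space types agree with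
`Plane` only after unfolding. -/
theorem Carries.unique_of_apply_eq {V W : Type*} [AddCommGroup V] [Module ℝ V] [AddCommGroup W]
    [Module ℝ W] {A A' : V →ₗ[ℝ] W} {o : Orientation ℝ V (Fin 2)} {o₁ o₂ : Orientation ℝ W (Fin 2)}
    (h₁ : Carries A o o₁) (h₂ : Carries A' o o₂) (h : ∀ v, A v = A' v) : o₁ = o₂ := by
  obtain rfl : A = A' := LinearMap.ext h
  exact h₁.unique h₂

variable {M : Type*} [TopologicalSpace M] [ChartedSpace Plane M]

theorem mfderiv_of_eventuallyEq_id {φ : M ≃ₘ^∞⟮𝓡 2, 𝓡 2⟯ M} {p : M} (h : φ =ᶠ[𝓝 p] id) (u : TangentSpace (𝓡 2) p) :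
    (mfderiv (𝓡 2) (𝓡 2) φ p u : Plane) = u := by
  have h1 := h.mfderiv_eq (I := 𝓡 2) (I' := 𝓡 2)
  rw [mfderiv_id] at h1
  exact DFunLike.congr_fun h1 u

variable [IsManifold (𝓡 2) ∞ M]

/-- A change of frame multiplies the Gram determinant by the square of its determinant; the square
root turns this into an absolute value. -/
theorem areaElement_linear (g : Metric M) (p : M) (A : Plane →ₗ[ℝ] TangentSpace (𝓡 2) p)
    (u v : Plane) : areaElement g p (A u) (A v) =
      areaElement g p (A (EuclideanSpace.single 0 1)) (A (EuclideanSpace.single 1 1)) *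
        |cross u v| := by
  set a := A (EuclideanSpace.single 0 1) with ha
  set b := A (EuclideanSpace.single 1 1) with hb
  have hu : ∀ w : Plane, A w = w 0 • a + w 1 • b := by
    intro w
    conv_lhs => rw [plane_eq w, map_add, map_smul, map_smul]
  have hsymm := g.symm p b a
  rw [areaElement, areaElement, ← Real.sqrt_sq_eq_abs, ← Real.sqrt_mul' _ (sq_nonneg _), hu, hu]
  congr 1
  simp only [map_add, map_smul, add_apply, smul_apply,
    smul_eq_mul, hsymm, cross]
  ring

/-- The area density in the chart `e`. -/
def chartDensity (g : Metric M) (e : OpenPartialHomeomorph M Plane) (y : Plane) : ℝ :=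
  areaElement g (e.symm y) (mfderiv (𝓡 2) (𝓡 2) e.symm y (EuclideanSpace.single 0 (1 : ℝ) : Plane))
    (mfderiv (𝓡 2) (𝓡 2) e.symm y (EuclideanSpace.single 1 (1 : ℝ) : Plane))

theorem mfderiv_symm_mfderiv {e : OpenPartialHomeomorph M Plane} (he : e ∈ atlas Plane M)
    {y : Plane} (hy : y ∈ e.target) (u : TangentSpace (𝓡 2) (e.symm y)) :
    mfderiv (𝓡 2) (𝓡 2) e.symm y (mfderiv (𝓡 2) (𝓡 2) e (e.symm y) u : Plane) = u := by
  have h := (mdifferentiable_of_mem_atlas (I := 𝓡 2) he).symm_comp_deriv (e.map_target hy)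
  rw [e.right_inv hy] at h
  exact DFunLike.congr_fun h u

theorem areaElement_eq (g : Metric M) {e : OpenPartialHomeomorph M Plane} (he : e ∈ atlas Plane M)
    {p : M} (hp : p ∈ e.source) (u v : TangentSpace (𝓡 2) p) :
    areaElement g p u v = chartDensity g e (e p) *
      |cross (mfderiv (𝓡 2) (𝓡 2) e p u : Plane) (mfderiv (𝓡 2) (𝓡 2) e p v : Plane)| := by
  obtain ⟨y, hy, rfl⟩ : ∃ y ∈ e.target, e.symm y = p := ⟨e p, e.map_source hp, e.left_inv hp⟩
  have h := areaElement_linear g (e.symm y) (mfderiv (𝓡 2) (𝓡 2) e.symm y).toLinearMap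
    (mfderiv (𝓡 2) (𝓡 2) e (e.symm y) u) (mfderiv (𝓡 2) (𝓡 2) e (e.symm y) v)
  have hu := mfderiv_symm_mfderiv he hy u
  have hv := mfderiv_symm_mfderiv he hy v
  rw [e.right_inv hy]
  refine Eq.trans ?_ h
  exact (congrArg₂ (areaElement g (e.symm y)) hu hv).symm

/-- The field is the tangent map of `e.symm` applied to a constant section. It is inserted into the
metric to show that the metric coefficients are smooth. -/
theorem contMDiffOn_chart_frame {e : OpenPartialHomeomorph M Plane} (he : e ∈ atlas Plane M)
    (v : Plane) : ContMDiffOn (𝓡 2) (𝓡 2).tangent ∞ (fun y : Plane =>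
      (Bundle.TotalSpace.mk' Plane (e.symm y) (mfderiv (𝓡 2) (𝓡 2) e.symm y v) :
        TangentBundle (𝓡 2) M)) e.target := by
  have h1 : ContMDiffOn (𝓡 2) (𝓡 2) ∞ e.symm e.target :=
    contMDiffOn_symm_of_mem_maximalAtlas (IsManifold.subset_maximalAtlas he)
  have h2 := h1.contMDiffOn_tangentMapWithin (m := ∞) (by simp) e.open_target.uniqueMDiffOn
  have h3 : ContMDiffOn (𝓡 2) (𝓡 2).tangent ∞
      (fun y : Plane => (⟨y, v⟩ : TangentBundle (𝓡 2) Plane)) e.target :=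
    contMDiffOn_vectorSpace_iff_contDiffOn.2 contDiffOn_const
  refine (h2.comp h3 fun y hy => hy).congr fun y hy => ?_
  simp only [Function.comp_apply, tangentMapWithin]
  rw [mfderivWithin_of_isOpen e.open_target hy]

theorem contDiffOn_metric_chart (g : Metric M) {e : OpenPartialHomeomorph M Plane}
    (he : e ∈ atlas Plane M) (u v : Plane) :
    ContDiffOn ℝ ∞ (fun y => g.inner (e.symm y) (mfderiv (𝓡 2) (𝓡 2) e.symm y u)
      (mfderiv (𝓡 2) (𝓡 2) e.symm y v)) e.target := by
  have h1 : ContMDiffOn (𝓡 2) (𝓡 2) ∞ e.symm e.target :=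
    contMDiffOn_symm_of_mem_maximalAtlas (IsManifold.subset_maximalAtlas he)
  refine ContMDiffOn.contDiffOn fun y hy => ?_
  have h2 : ContMDiffWithinAt (𝓡 2) ((𝓡 2).prod 𝓘(ℝ)) ∞
      (fun y => Bundle.TotalSpace.mk' ℝ (E := Bundle.Trivial M ℝ) (e.symm y)
        (g.inner (e.symm y) (mfderiv (𝓡 2) (𝓡 2) e.symm y u)
          (mfderiv (𝓡 2) (𝓡 2) e.symm y v))) e.target y := by
    apply ContMDiffWithinAt.clm_bundle_apply₂ (F₁ := Plane) (F₂ := Plane)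
    · exact g.contMDiff.contMDiffAt.comp_contMDiffWithinAt y (h1 y hy)
    · exact contMDiffOn_chart_frame he u y hy
    · exact contMDiffOn_chart_frame he v y hy
  simp only [Bundle.contMDiffWithinAt_totalSpace] at h2
  exact h2.2

/-- The squared norm of -⟨a,b⟩a + ⟨a,a⟩b is ⟨a,a⟩ times the Gram determinant, and this vector is
nonzero by independence. -/
theorem gram_pos (g : Metric M) (p : M) {a b : TangentSpace (𝓡 2) p}
    (h : ∀ s t : ℝ, s • a + t • b = 0 → s = 0 ∧ t = 0) :
    0 < g.inner p a a * g.inner p b b - g.inner p a b ^ 2 := by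
  have ha : a ≠ 0 := fun h0 => one_ne_zero (h 1 0 (by simp [h0])).1
  have hpa := g.pos p a ha
  have hne : (-(g.inner p a b)) • a + (g.inner p a a) • b ≠ 0 := fun h0 => hpa.ne' (h _ _ h0).2
  have h1 := g.pos p _ hne
  have hsymm := g.symm p b a
  simp only [map_add, map_smul, add_apply, smul_apply,
    smul_eq_mul, hsymm] at h1
  have h2 : 0 < g.inner p a a * (g.inner p a a * g.inner p b b - g.inner p a b ^ 2) := by
    linarith
  exact (pos_iff_pos_of_mul_pos h2).1 hpa

theorem gram_chart_pos (g : Metric M) {e : OpenPartialHomeomorph M Plane} (he : e ∈ atlas Plane M)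
    {y : Plane} (hy : y ∈ e.target) :
    0 < g.inner (e.symm y)
          (mfderiv (𝓡 2) (𝓡 2) e.symm y (EuclideanSpace.single 0 (1 : ℝ) : Plane))
          (mfderiv (𝓡 2) (𝓡 2) e.symm y (EuclideanSpace.single 0 (1 : ℝ) : Plane)) *
        g.inner (e.symm y)
          (mfderiv (𝓡 2) (𝓡 2) e.symm y (EuclideanSpace.single 1 (1 : ℝ) : Plane))
          (mfderiv (𝓡 2) (𝓡 2) e.symm y (EuclideanSpace.single 1 (1 : ℝ) : Plane)) -
        g.inner (e.symm y)
          (mfderiv (𝓡 2) (𝓡 2) e.symm y (EuclideanSpace.single 0 (1 : ℝ) : Plane))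
          (mfderiv (𝓡 2) (𝓡 2) e.symm y (EuclideanSpace.single 1 (1 : ℝ) : Plane)) ^ 2 := by
  refine gram_pos g _ fun s t hst => ?_
  have h := (mdifferentiable_of_mem_atlas (I := 𝓡 2) he).comp_symm_deriv hy
  have h1 : mfderiv (𝓡 2) (𝓡 2) e.symm y
      (s • EuclideanSpace.single 0 (1 : ℝ) + t • EuclideanSpace.single 1 (1 : ℝ) : Plane) = 0 := by
    refine Eq.trans ?_ hst
    exact (map_add (mfderiv (𝓡 2) (𝓡 2) e.symm y) _ _).trans
      (congrArg₂ _ (map_smul _ _ _) (map_smul _ _ _))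
  have h2 := DFunLike.congr_fun h
    (s • EuclideanSpace.single 0 (1 : ℝ) + t • EuclideanSpace.single 1 (1 : ℝ) : Plane)
  have h3 : (0 : Plane) =
      (s • EuclideanSpace.single 0 (1 : ℝ) + t • EuclideanSpace.single 1 (1 : ℝ) : Plane) := by
    refine Eq.trans ?_ h2
    refine Eq.trans ?_ (congrArg (mfderiv (𝓡 2) (𝓡 2) e (e.symm y)) h1).symm
    exact (map_zero (mfderiv (𝓡 2) (𝓡 2) e (e.symm y))).symm
  have h4 := congrArg (fun w : Plane => w 0) h3
  have h5 := congrArg (fun w : Plane => w 1) h3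
  simp at h4 h5
  exact ⟨h4.symm, h5.symm⟩

theorem chartDensity_pos (g : Metric M) {e : OpenPartialHomeomorph M Plane}
    (he : e ∈ atlas Plane M) {y : Plane} (hy : y ∈ e.target) : 0 < chartDensity g e y :=
  Real.sqrt_pos.2 (gram_chart_pos g he hy)

theorem contDiffOn_chartDensity (g : Metric M) {e : OpenPartialHomeomorph M Plane}
    (he : e ∈ atlas Plane M) : ContDiffOn ℝ ∞ (chartDensity g e) e.target := by
  refine ContDiffOn.sqrt ?_ fun y hy => (gram_chart_pos g he hy).ne'
  exact ((contDiffOn_metric_chart g he _ _).mul (contDiffOn_metric_chart g he _ _)).sub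
    ((contDiffOn_metric_chart g he _ _).pow 2)

variable {φ : M ≃ₘ^∞⟮𝓡 2, 𝓡 2⟯ M} {e : OpenPartialHomeomorph M Plane}
  {Φ : Plane ≃ₘ^∞⟮𝓡 2, 𝓡 2⟯ Plane}

/-- The chain rule for a diffeomorphism that preserves the domain of a chart. -/
theorem mfderiv_chart_comp (he : e ∈ atlas Plane M)
    (hφ : ∀ p ∈ e.source, φ p ∈ e.source ∧ e (φ p) = Φ (e p)) {p : M} (hp : p ∈ e.source)
    (u : TangentSpace (𝓡 2) p) :
    (mfderiv (𝓡 2) (𝓡 2) e (φ p) (mfderiv (𝓡 2) (𝓡 2) φ p u) : Plane) =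
      fderiv ℝ Φ (e p) (mfderiv (𝓡 2) (𝓡 2) e p u : Plane) := by
  have hnear : (e ∘ φ : M → Plane) =ᶠ[𝓝 p] Φ ∘ e := by
    filter_upwards [e.open_source.mem_nhds hp] with q hq using (hφ q hq).2
  have h1 := hnear.mfderiv_eq (I := 𝓡 2) (I' := 𝓡 2)
  rw [mfderiv_comp p (mdifferentiableAt_atlas he (hφ p hp).1) (φ.mdifferentiable (by simp) p),
    mfderiv_comp p (Φ.mdifferentiable (by simp) _) (mdifferentiableAt_atlas he hp),
    mfderiv_eq_fderiv] at h1
  exact DFunLike.congr_fun h1 u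

theorem lift_of_eventuallyEq_id {x : OrientationCover M} (h : φ =ᶠ[𝓝 x.pt] id) :
    lift φ x = x := by
  refine ext_plane h.eq_of_nhds ?_
  have h1 := lift_carries φ x
  exact Carries.unique_of_apply_eq (V := Plane) (W := Plane) h1 (carries_id (V := Plane) x.orient)
    (mfderiv_of_eventuallyEq_id h)

/-- Inside the chart the factor det DΦ from the parallelogram is compensated by the change of
density; outside, the derivative is the identity. -/
theorem mem_SDiff_of_chart (g : Metric M) (he : e ∈ atlas Plane M)
    (hφ : ∀ p ∈ e.source, φ p ∈ e.source ∧ e (φ p) = Φ (e p))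
    (hφ' : ∀ p ∉ e.source, φ =ᶠ[𝓝 p] id)
    (hpos : ∀ y, 0 < LinearMap.det (fderiv ℝ Φ y : Plane →ₗ[ℝ] Plane))
    (hdet : ∀ y, chartDensity g e (Φ y) * LinearMap.det (fderiv ℝ Φ y : Plane →ₗ[ℝ] Plane) =
      chartDensity g e y) : φ ∈ SDiff g := by
  intro p u v
  by_cases hp : p ∈ e.source
  · rw [areaElement_eq g he (hφ p hp).1, areaElement_eq g he hp, mfderiv_chart_comp he hφ hp,
      mfderiv_chart_comp he hφ hp, (hφ p hp).2]
    have := cross_map (fderiv ℝ Φ (e p)).toLinearMap (mfderiv (𝓡 2) (𝓡 2) e p u)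
      (mfderiv (𝓡 2) (𝓡 2) e p v)
    simp only [ContinuousLinearMap.coe_coe] at this
    rw [this, abs_mul, abs_of_pos (hpos _), ← mul_assoc, hdet]
  · have h := hφ' p hp
    have key : ∀ q : M, q = p → ∀ a b : Plane, areaElement g q a b = areaElement g p a b := by
      rintro q rfl a b; rfl
    refine Eq.trans (key _ h.eq_of_nhds _ _) ?_
    exact congrArg₂ (areaElement g p) (mfderiv_of_eventuallyEq_id h u)
      (mfderiv_of_eventuallyEq_id h v)

theorem carries_of_det_pos (A : Plane →ₗ[ℝ] Plane) (hA : 0 < LinearMap.det A)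
    (o : Orientation ℝ Plane (Fin 2)) : Carries A o o := by
  refine ⟨LinearMap.equivOfDetNeZero A hA.ne', rfl, ?_⟩
  rw [Orientation.map_eq_iff_det_pos _ _ (by simp)]
  exact hA

theorem lift_carries_chart (he : e ∈ atlas Plane M)
    (hφ : ∀ p ∈ e.source, φ p ∈ e.source ∧ e (φ p) = Φ (e p))
    (hpos : ∀ y, 0 < LinearMap.det (fderiv ℝ Φ y : Plane →ₗ[ℝ] Plane))
    {x : OrientationCover M} (hx : x.pt ∈ e.source) {o : Orientation ℝ Plane (Fin 2)}
    (ho : Carries (W := Plane) (mfderiv (𝓡 2) (𝓡 2) e x.pt).toLinearMap x.orient o) :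
    Carries (W := Plane) (mfderiv (𝓡 2) (𝓡 2) e (lift φ x).pt).toLinearMap
      (lift φ x).orient o := by
  obtain ⟨o', ho'⟩ := exists_carries (lift φ x) he (hφ _ hx).1
  have h1 := ho'.comp (lift_carries φ x)
  have h2 := (carries_of_det_pos _ (hpos (e x.pt)) o).comp ho
  -- Both orientations are the transport of `x.orient` to the plane: one through the lift and then
  -- the chart, the other through the chart and then the orientation-preserving derivative of Φ.
  have h3 : o' = o := Carries.unique_of_apply_eq (W := Plane) h1 h2
    (mfderiv_chart_comp he hφ hx)
  rwa [← h3]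

/-- Area-preserving diffeomorphisms supported in a given open set move an oriented point of this
set to any nearby oriented point. -/
theorem exists_local_move [T2Space M] (g : Metric M) (x : OrientationCover M) {V : Set M}
    (hV : IsOpen V) (hx : x.pt ∈ V) :
    ∃ W ∈ 𝓝 x, ∀ x' ∈ W, ∃ φ ∈ SDiff g, lift φ x = x' ∧ ∀ z, z.pt ∉ V → lift φ z = z := by
  let e := chartAt Plane x.pt
  have he : e ∈ atlas Plane M := chart_mem_atlas _ _
  have hxe : x.pt ∈ e.source := mem_chart_source Plane x.pt
  obtain ⟨o, ho⟩ := exists_carries x he hxe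
  have hU : IsOpen (e.target ∩ e.symm ⁻¹' V) := e.symm.isOpen_inter_preimage hV
  have hy₀ : e x.pt ∈ e.target ∩ e.symm ⁻¹' V :=
    ⟨e.map_source hxe, by rwa [mem_preimage, e.left_inv hxe]⟩
  obtain ⟨K, hKU, hK, W₀, hW₀, hmove⟩ := exists_planar_diffeomorph hU
    ((contDiffOn_chartDensity g he).mono inter_subset_left)
    (fun y hy => chartDensity_pos g he hy.1) hy₀
  let S := sheetHomeo e he o
  have hxS : x ∈ S.source := ⟨hxe, ho⟩
  -- Staying in a single sheet fixes the orientation, so the lift reaches `x'` itself and not its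
  -- flip.
  refine ⟨S.source ∩ S ⁻¹' W₀, Filter.inter_mem (S.open_source.mem_nhds hxS)
    ((S.continuousAt hxS).preimage_mem_nhds hW₀), ?_⟩
  rintro x' ⟨⟨hx'e, ho'⟩, hx'W⟩
  obtain ⟨Φ, hΦK, hΦx, hpos, hdet⟩ := hmove _ hx'W
  have hKe : K ⊆ e.target := hKU.trans inter_subset_left
  obtain ⟨φ, hφ, hφK⟩ := exists_diffeomorph_extendChart
    (contMDiffOn_of_mem_maximalAtlas (IsManifold.subset_maximalAtlas he))
    (contMDiffOn_symm_of_mem_maximalAtlas (IsManifold.subset_maximalAtlas he))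
    Φ.contDiff Φ.symm.contDiff Φ.symm_apply_apply Φ.apply_symm_apply hΦK hK hKe
  have hφe : ∀ p ∈ e.source, φ p ∈ e.source ∧ e (φ p) = Φ (e p) := by
    intro p hp
    refine ⟨(hφ p hp).1, ?_⟩
    rw [(hφ p hp).2, e.right_inv]
    exact mapsTo_of_eq_off Φ.injective hΦK hKe (e.map_source hp)
  have hoff : ∀ p ∉ e.symm '' K, φ =ᶠ[𝓝 p] id := by
    intro p hp
    filter_upwards [(isCompact_symm_image hK hKe).isClosed.isOpen_compl.mem_nhds hp] with q hq
    exact hφK q hq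
  refine ⟨φ, mem_SDiff_of_chart g he hφe (fun p hp => hoff p ?_) hpos hdet, ?_, fun z hz =>
    lift_of_eventuallyEq_id (hoff _ ?_)⟩
  · rintro ⟨y, hy, rfl⟩
    exact hp (e.map_target (hKe hy))
  · refine orient_eq_of_carries (e := e) ?_ (lift_carries_chart he hφe hpos hxe ho) ho'
    change φ x.pt = x'.pt
    rw [(hφ _ hxe).2, hΦx]
    exact e.left_inv hx'e
  · rintro ⟨y, hy, hyz⟩
    exact hz (hyz ▸ (hKU hy).2)

end AreaPreserving

/-! ### Connectedness after removing finitely many points -/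

section Puncture

/-- Removing a closed set does not disconnect a space if this holds locally. -/
theorem eq_empty_of_isOpen_partition_compl {X : Type*} [TopologicalSpace X] [PreconnectedSpace X]
    {F A B : Set X} (hd : Dense Fᶜ) (hF : ∀ p ∈ F, ∃ U ∈ 𝓝 p, IsPreconnected (U \ F))
    (hA : IsOpen A) (hB : IsOpen B) (hAB : Disjoint A B) (hcover : A ∪ B = Fᶜ)
    (hne : A.Nonempty) : B = ∅ := by
  by_contra hB0
  obtain ⟨a, ha⟩ := hne
  obtain ⟨b, hb⟩ := nonempty_iff_ne_empty.2 hB0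
  have hAi : A ⊆ interior (A ∪ F) := interior_maximal subset_union_left hA
  have hBi : B ⊆ interior (B ∪ F) := interior_maximal subset_union_left hB
  -- A punctured connected neighbourhood of a removed point lies wholly in `A` or wholly in `B`, so
  -- the point can be added to that side. By connectedness the two enlarged open sets meet, and by
  -- density they meet outside `F`, where `A` and `B` are disjoint.
  have hun : (univ : Set X) ⊆ interior (A ∪ F) ∪ interior (B ∪ F) := by
    intro p _
    by_cases hp : p ∈ F
    · obtain ⟨U, hU, hUF⟩ := hF p hp
      have hsub : U \ F ⊆ A ∪ B := by rw [hcover]; exact fun q hq => hq.2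
      rcases hUF.subset_or_subset hA hB hAB hsub with h | h
      · exact Or.inl (mem_interior_iff_mem_nhds.2 (Filter.mem_of_superset hU fun q hq =>
          or_iff_not_imp_right.2 fun hqF => h ⟨hq, hqF⟩))
      · exact Or.inr (mem_interior_iff_mem_nhds.2 (Filter.mem_of_superset hU fun q hq =>
          or_iff_not_imp_right.2 fun hqF => h ⟨hq, hqF⟩))
    · have : p ∈ A ∪ B := by rw [hcover]; exact hp
      exact this.imp (fun h => hAi h) (fun h => hBi h)
  obtain ⟨q, -, hq⟩ := isPreconnected_univ _ _ isOpen_interior isOpen_interior hun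
    ⟨a, trivial, hAi ha⟩ ⟨b, trivial, hBi hb⟩
  obtain ⟨r, hr, hrF⟩ := hd.inter_open_nonempty _ (isOpen_interior.inter isOpen_interior) ⟨q, hq⟩
  have h1 := (interior_subset hr.1).resolve_right hrF
  have h2 := (interior_subset hr.2).resolve_right hrF
  exact hAB.le_bot ⟨h1, h2⟩

theorem one_lt_rank_plane : 1 < Module.rank ℝ Plane := by
  rw [← Module.finrank_eq_rank, finrank_euclideanSpace_fin]
  norm_num

theorem exists_plane_embedding {X : Type*} [TopologicalSpace X] [ChartedSpace Plane X] (p : X) :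
    ∃ ι : Plane → X, Topology.IsOpenEmbedding ι ∧ ι 0 = p := by
  let e := chartAt Plane p
  have hp : p ∈ e.source := mem_chart_source Plane p
  obtain ⟨r, hr, hre⟩ := Metric.isOpen_iff.1 e.open_target (e p) (e.map_source hp)
  have hb : ∀ z, OpenPartialHomeomorph.univBall (e p) r z ∈ Metric.ball (e p) r := by
    intro z
    rw [← OpenPartialHomeomorph.univBall_target (e p) hr]
    refine OpenPartialHomeomorph.map_source _ ?_
    rw [OpenPartialHomeomorph.univBall_source]
    exact mem_univ z
  refine ⟨(OpenPartialHomeomorph.univBall (e p) r).trans e.symm,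
    OpenPartialHomeomorph.isOpenEmbedding _ ?_, ?_⟩
  · rw [OpenPartialHomeomorph.trans_source, OpenPartialHomeomorph.univBall_source, univ_inter]
    exact eq_univ_of_forall fun z => hre (hb z)
  · rw [OpenPartialHomeomorph.coe_trans, Function.comp_apply,
      OpenPartialHomeomorph.univBall_apply_zero, e.left_inv hp]

variable {X : Type*} [TopologicalSpace X] [ChartedSpace Plane X] {F : Set X}

theorem dense_compl_of_finite (hF : F.Finite) : Dense Fᶜ := by
  intro p
  rw [mem_closure_iff]
  intro U hU hp
  obtain ⟨ι, hι, rfl⟩ := exists_plane_embedding p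
  have : Nontrivial Plane := inferInstance
  obtain ⟨z, hz, hzF⟩ := ((hF.preimage hι.injective.injOn).countable.dense_compl ℝ).inter_open_nonempty
    (ι ⁻¹' U) (hU.preimage hι.continuous) ⟨0, hp⟩
  exact ⟨ι z, hz, hzF⟩

/-- An embedded copy of the plane serves as neighbourhood: in real dimension greater than one, the
complement of a countable set is connected. -/
theorem exists_isPreconnected_diff (hF : F.Finite) (p : X) :
    ∃ U ∈ 𝓝 p, IsPreconnected (U \ F) := by
  obtain ⟨ι, hι, rfl⟩ := exists_plane_embedding p
  refine ⟨range ι, hι.isOpen_range.mem_nhds (mem_range_self 0), ?_⟩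
  have h := ((hF.preimage hι.injective.injOn).countable.isConnected_compl_of_one_lt_rank
    one_lt_rank_plane).isPreconnected.image ι hι.continuous.continuousOn
  convert h using 1
  ext q
  constructor
  · rintro ⟨⟨z, rfl⟩, hz⟩
    exact ⟨z, hz, rfl⟩
  · rintro ⟨z, hz, rfl⟩
    exact ⟨mem_range_self z, hz⟩

end Puncture

/-! ### Topology of the orientation double cover -/

section Cover
variable {M : Type*} [TopologicalSpace M] [ChartedSpace Plane M]

theorem flip_flip (x : OrientationCover M) : flip (flip x) = x := by
  exact ext_plane rfl (neg_neg (x.orient : Orientation ℝ Plane (Fin 2)))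

theorem orient_eq_or_eq_neg (o o' : Orientation ℝ Plane (Fin 2)) : o = o' ∨ o = -o' :=
  o.eq_or_eq_neg o' (by simp)

theorem orient_ne_neg (o : Orientation ℝ Plane (Fin 2)) : o ≠ -o :=
  Module.Ray.ne_neg_self o

theorem eq_or_eq_flip {x y : OrientationCover M} (h : x.pt = y.pt) : x = y ∨ x = flip y := by
  rcases orient_eq_or_eq_neg x.orient y.orient with h' | h'
  · exact Or.inl (ext_plane h h')
  · exact Or.inr (ext_plane h h')

theorem exists_pt_eq (p : M) : ∃ x : OrientationCover M, x.pt = p :=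
  ⟨⟨p, (EuclideanSpace.basisFun (Fin 2) ℝ).toBasis.orientation⟩, rfl⟩

variable [IsManifold (𝓡 2) ∞ M]

theorem exists_mem_sheet (x : OrientationCover M) :
    ∃ (e : OpenPartialHomeomorph M Plane) (he : e ∈ atlas Plane M)
      (o : Orientation ℝ Plane (Fin 2)), x ∈ (sheetHomeo e he o).source := by
  obtain ⟨o, ho⟩ := exists_carries x (chart_mem_atlas Plane x.pt) (mem_chart_source Plane x.pt)
  exact ⟨_, chart_mem_atlas Plane x.pt, o, mem_chart_source Plane x.pt, ho⟩

theorem continuous_pt : Continuous (OrientationCover.pt : OrientationCover M → M) := by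
  refine continuous_iff_continuousAt.2 fun x => ?_
  obtain ⟨e, he, o, hx⟩ := exists_mem_sheet x
  have h : ContinuousAt (e.symm ∘ sheetHomeo e he o) x :=
    ContinuousAt.comp (f := sheetHomeo e he o) (e.continuousAt_symm (e.map_source hx.1))
      ((sheetHomeo e he o).continuousAt hx)
  refine h.congr ?_
  filter_upwards [(sheetHomeo e he o).open_source.mem_nhds hx] with z hz using e.left_inv hz.1

theorem isOpenMap_pt : IsOpenMap (OrientationCover.pt : OrientationCover M → M) := by
  intro U hU
  refine isOpen_iff_mem_nhds.2 ?_
  rintro _ ⟨x, hxU, rfl⟩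
  obtain ⟨e, he, o, hx⟩ := exists_mem_sheet x
  let S := sheetHomeo e he o
  have hxU' : S.symm (S x) ∈ U := by rwa [S.left_inv hx]
  have h1 : S.target ∩ S.symm ⁻¹' U ∈ 𝓝 (e x.pt) :=
    (S.symm.isOpen_inter_preimage hU).mem_nhds ⟨S.map_source hx, hxU'⟩
  filter_upwards [e.open_source.mem_nhds hx.1, (e.continuousAt hx.1).preimage_mem_nhds h1]
    with p hp hp'
  exact ⟨S.symm (e p), hp'.2, e.left_inv hp⟩

theorem mem_sheet_flip {e : OpenPartialHomeomorph M Plane} (he : e ∈ atlas Plane M)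
    {o : Orientation ℝ Plane (Fin 2)} {x : OrientationCover M}
    (hx : x ∈ (sheetHomeo e he o).source) : flip x ∈ (sheetHomeo e he (-o)).source :=
  ⟨hx.1, hx.2.neg⟩

theorem mem_sheet_or {e : OpenPartialHomeomorph M Plane} (he : e ∈ atlas Plane M)
    (o : Orientation ℝ Plane (Fin 2)) {x : OrientationCover M} (hx : x.pt ∈ e.source) :
    x ∈ (sheetHomeo e he o).source ∨ x ∈ (sheetHomeo e he (-o)).source := by
  obtain ⟨o', ho'⟩ := exists_carries x he hx
  rcases orient_eq_or_eq_neg o' o with rfl | rfl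
  · exact Or.inl ⟨hx, ho'⟩
  · exact Or.inr ⟨hx, ho'⟩

theorem disjoint_sheet {e : OpenPartialHomeomorph M Plane} (he : e ∈ atlas Plane M)
    (o : Orientation ℝ Plane (Fin 2)) :
    Disjoint (sheetHomeo e he o).source (sheetHomeo e he (-o)).source :=
  Set.disjoint_left.2 fun _ h h' => orient_ne_neg o (h.2.unique h'.2)

theorem continuous_flip : Continuous (flip : OrientationCover M → OrientationCover M) := by
  refine continuous_iff_continuousAt.2 fun x => ?_
  obtain ⟨e, he, o, hx⟩ := exists_mem_sheet x
  have h : ContinuousAt ((sheetHomeo e he (-o)).symm ∘ sheetHomeo e he o) x :=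
    ContinuousAt.comp (f := sheetHomeo e he o)
      ((sheetHomeo e he (-o)).continuousAt_symm (e.map_source hx.1))
      ((sheetHomeo e he o).continuousAt hx)
  refine h.congr ?_
  filter_upwards [(sheetHomeo e he o).open_source.mem_nhds hx] with z hz
  exact (sheetHomeo e he (-o)).left_inv (mem_sheet_flip he hz)

/-- Points over different base points are separated downstairs; the two points of a fibre are
separated by opposite sheets of one chart. -/
instance [T2Space M] : T2Space (OrientationCover M) := by
  refine ⟨fun x y hxy => ?_⟩
  by_cases h : x.pt = y.pt
  · obtain rfl := (eq_or_eq_flip h.symm).resolve_left hxy.symm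
    obtain ⟨e, he, o, hx⟩ := exists_mem_sheet x
    exact ⟨_, _, (sheetHomeo e he o).open_source, (sheetHomeo e he (-o)).open_source, hx,
      mem_sheet_flip he hx, disjoint_sheet he o⟩
  · obtain ⟨U, V, hU, hV, hx, hy, hUV⟩ := t2_separation h
    exact ⟨_, _, hU.preimage continuous_pt, hV.preimage continuous_pt, hx, hy, hUV.preimage _⟩

/-- The orientation cover of a connected non-orientable surface is connected. -/
theorem preconnectedSpace_cover [PreconnectedSpace M] (hM : ¬ IsOrientable M) :
    PreconnectedSpace (OrientationCover M) := by
  -- For clopen `A`, the base points with both lifts in `A`, and those with no lift in `A`, form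
  -- clopen sets. If one of them is everything, `A` is trivial. Otherwise both are empty, and `A`
  -- contains exactly one lift of each point, which gives a continuous orientation.
  refine preconnectedSpace_iff_clopen.2 fun A hA => ?_
  have hopen : ∀ B C : Set (OrientationCover M), IsOpen B → IsOpen C →
      IsOpen (OrientationCover.pt '' (B ∩ flip ⁻¹' C)) := fun B C hB hC =>
    isOpenMap_pt _ (hB.inter (hC.preimage continuous_flip))
  have hclopen : ∀ B : Set (OrientationCover M), IsClopen B →
      IsClopen (OrientationCover.pt '' (B ∩ flip ⁻¹' B)) := by
    intro B hB
    refine ⟨⟨?_⟩, hopen _ _ hB.isOpen hB.isOpen⟩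
    -- The complement consists of the points with some lift outside `B`, the image of an open set
    -- under the open projection. The vacuous preimage of `univ` only matches the form of `hopen`.
    have : (OrientationCover.pt '' (B ∩ flip ⁻¹' B))ᶜ =
        OrientationCover.pt '' (Bᶜ ∩ flip ⁻¹' univ) := by
      ext p
      constructor
      · intro hp
        obtain ⟨x, rfl⟩ := exists_pt_eq p
        by_cases hx : x ∈ B
        · refine ⟨flip x, ⟨fun h => hp ⟨x, ⟨hx, h⟩, rfl⟩, trivial⟩, rfl⟩
        · exact ⟨x, ⟨hx, trivial⟩, rfl⟩
      · rintro ⟨x, ⟨hx, -⟩, rfl⟩ ⟨y, ⟨hy, hy'⟩, h⟩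
        rcases eq_or_eq_flip h.symm with rfl | rfl
        · exact hx hy
        · exact hx hy'
    rw [this]
    exact hopen _ _ hB.compl.isOpen isOpen_univ
  have huniv : ∀ B : Set (OrientationCover M),
      OrientationCover.pt '' (B ∩ flip ⁻¹' B) = univ → B = univ := by
    intro B hB
    refine eq_univ_of_forall fun x => ?_
    obtain ⟨y, ⟨hy, hy'⟩, h⟩ : x.pt ∈ OrientationCover.pt '' (B ∩ flip ⁻¹' B) := hB ▸ trivial
    rcases eq_or_eq_flip h.symm with rfl | rfl
    · exact hy
    · exact hy'
  rcases isClopen_iff.1 (hclopen A hA) with h2 | h2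
  swap
  · exact Or.inr (huniv A h2)
  rcases isClopen_iff.1 (hclopen Aᶜ hA.compl) with h0 | h0
  swap
  · exact Or.inl (compl_univ_iff.1 (huniv _ h0))
  have hex : ∀ p : M, ∃ x ∈ A, x.pt = p := by
    intro p
    obtain ⟨x, rfl⟩ := exists_pt_eq p
    by_cases hx : x ∈ A
    · exact ⟨x, hx, rfl⟩
    · refine ⟨flip x, ?_, rfl⟩
      by_contra hx'
      exact eq_empty_iff_forall_notMem.1 h0 x.pt ⟨x, ⟨hx, hx'⟩, rfl⟩
  choose s hsA hs using hex
  refine absurd ⟨s, continuous_def.2 fun U hU => ?_, hs⟩ hM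
  -- Since `A` meets each fibre only once, a point of `A` over `p` must be `s p`.
  have : s ⁻¹' U = OrientationCover.pt '' (A ∩ U) := by
    ext p
    constructor
    · exact fun hp => ⟨s p, ⟨hsA p, hp⟩, hs p⟩
    · rintro ⟨x, ⟨hxA, hxU⟩, rfl⟩
      rcases eq_or_eq_flip (hs x.pt) with h | h
      · exact (congrArg (· ∈ U) h).mpr hxU
      · exact absurd ⟨x, ⟨hxA, (congrArg (· ∈ A) h).mp (hsA x.pt)⟩, rfl⟩ (eq_empty_iff_forall_notMem.1 h2 x.pt)
  rw [this]
  exact isOpenMap_pt _ (hA.isOpen.inter hU)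

end Cover

/-! ### Group structure of SDiff and transitivity on configurations -/

section Group
variable {M : Type*} [TopologicalSpace M] [ChartedSpace Plane M] [IsManifold (𝓡 2) ∞ M]

theorem lift_refl (x : OrientationCover M) : lift (Diffeomorph.refl (𝓡 2) M ∞) x = x :=
  lift_of_eventuallyEq_id (φ := Diffeomorph.refl (𝓡 2) M ∞) (Filter.EventuallyEq.refl _ _)

theorem lift_trans (φ ψ : M ≃ₘ^∞⟮𝓡 2, 𝓡 2⟯ M) (x : OrientationCover M) :
    lift (φ.trans ψ) x = lift ψ (lift φ x) := by
  refine ext_plane rfl ?_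
  refine Carries.unique_of_apply_eq (V := Plane) (W := Plane) (lift_carries (φ.trans ψ) x)
    ((lift_carries ψ (lift φ x)).comp (lift_carries φ x)) fun u => ?_
  exact DFunLike.congr_fun (mfderiv_comp x.pt (ψ.mdifferentiable (by simp) _)
    (φ.mdifferentiable (by simp) _)) u

theorem lift_lift_symm (φ : M ≃ₘ^∞⟮𝓡 2, 𝓡 2⟯ M) (x : OrientationCover M) :
    lift φ (lift φ.symm x) = x := lift_symm_lift φ.symm x

theorem refl_mem_SDiff (g : Metric M) : Diffeomorph.refl (𝓡 2) M ∞ ∈ SDiff g := by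
  intro p u v
  have h : ∀ w : TangentSpace (𝓡 2) p,
      mfderiv (𝓡 2) (𝓡 2) (Diffeomorph.refl (𝓡 2) M ∞) p w = w :=
    fun w => DFunLike.congr_fun (mfderiv_id (I := 𝓡 2) (x := p)) w
  exact congrArg₂ (areaElement g p) (h u) (h v)

theorem trans_mem_SDiff {g : Metric M} {φ ψ : M ≃ₘ^∞⟮𝓡 2, 𝓡 2⟯ M} (hφ : φ ∈ SDiff g)
    (hψ : ψ ∈ SDiff g) : φ.trans ψ ∈ SDiff g := by
  intro p u v
  rw [← hφ p u v, ← hψ (φ p)]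
  have h := mfderiv_comp p (ψ.mdifferentiable (by simp) (φ p)) (φ.mdifferentiable (by simp) p)
  exact congrArg₂ (areaElement g (ψ (φ p))) (DFunLike.congr_fun h u) (DFunLike.congr_fun h v)

theorem symm_mem_SDiff {g : Metric M} {φ : M ≃ₘ^∞⟮𝓡 2, 𝓡 2⟯ M} (hφ : φ ∈ SDiff g) :
    φ.symm ∈ SDiff g := by
  intro p u v
  rw [← hφ (φ.symm p)]
  have h := mfderiv_comp p (φ.mdifferentiable (by simp) (φ.symm p))
    (φ.symm.mdifferentiable (by simp) p)
  have h4 : (φ ∘ φ.symm) = (id : M → M) := funext φ.apply_symm_apply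
  rw [h4, mfderiv_id] at h
  have key : ∀ q : M, q = p → ∀ a b : Plane, areaElement g q a b = areaElement g p a b := by
    rintro q rfl a b; rfl
  refine (key _ (φ.apply_symm_apply p) _ _).trans ?_
  exact congrArg₂ (areaElement g p) (DFunLike.congr_fun h u).symm (DFunLike.congr_fun h v).symm

variable [T2Space M] [PreconnectedSpace M]

/-- Area-preserving diffeomorphisms which fix the oriented points over a finite set act
transitively on the remaining oriented points. -/
theorem exists_move_fixing (g : Metric M) (hM : ¬ IsOrientable M) {F : Set M} (hF : F.Finite)
    {x x' : OrientationCover M} (hx : x.pt ∉ F) (hx' : x'.pt ∉ F) :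
    ∃ φ ∈ SDiff g, lift φ x = x' ∧ ∀ z, z.pt ∈ F → lift φ z = z := by
  have := preconnectedSpace_cover hM
  let F' : Set (OrientationCover M) := OrientationCover.pt ⁻¹' F
  have hF' : F'.Finite := by
    choose s hs using exists_pt_eq (M := M)
    refine ((hF.image s).union (hF.image fun p => flip (s p))).subset fun z hz => ?_
    rcases eq_or_eq_flip (hs z.pt).symm with h | h
    · exact Or.inl ⟨z.pt, hz, h.symm⟩
    · exact Or.inr ⟨z.pt, hz, h.symm⟩
  -- This is the orbit of `x` under the subgroup fixing all oriented points over `F`. Local moves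
  -- make it and its complement off `F'` open; the punctured cover is connected, so that complement
  -- is empty.
  let A : Set (OrientationCover M) :=
    {z | ∃ φ ∈ SDiff g, lift φ x = z ∧ ∀ z, z.pt ∈ F → lift φ z = z}
  have hmove : ∀ z, z.pt ∉ F → ∃ W ∈ 𝓝 z, ∀ z' ∈ W, z'.pt ∉ F ∧
      ∃ φ ∈ SDiff g, lift φ z = z' ∧ ∀ z, z.pt ∈ F → lift φ z = z := by
    intro z hz
    obtain ⟨W, hW, h⟩ := exists_local_move g z hF.isClosed.isOpen_compl hz
    refine ⟨W ∩ F'ᶜ, Filter.inter_mem hW (hF'.isClosed.isOpen_compl.mem_nhds hz), ?_⟩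
    rintro z' ⟨hz'W, hz'⟩
    obtain ⟨φ, hφ, h1, h2⟩ := h z' hz'W
    exact ⟨hz', φ, hφ, h1, fun w hw => h2 w fun h => h hw⟩
  have hAF : A ⊆ F'ᶜ := by
    rintro z ⟨φ, hφ, rfl, hfix⟩ hz
    have h1 := congrArg (lift φ.symm) (hfix _ hz)
    rw [lift_symm_lift, lift_symm_lift] at h1
    exact hx (h1 ▸ hz)
  have hA : IsOpen A := by
    refine isOpen_iff_mem_nhds.2 fun z hz => ?_
    obtain ⟨W, hW, h⟩ := hmove z (hAF hz)
    obtain ⟨φ, hφ, rfl, hfix⟩ := hz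
    refine Filter.mem_of_superset hW fun z' hz' => ?_
    obtain ⟨-, ψ, hψ, rfl, hfix'⟩ := h z' hz'
    exact ⟨φ.trans ψ, trans_mem_SDiff hφ hψ, lift_trans _ _ _, fun w hw => by
      rw [lift_trans, hfix w hw, hfix' w hw]⟩
  have hB : IsOpen (F'ᶜ \ A) := by
    refine isOpen_iff_mem_nhds.2 fun z hz => ?_
    obtain ⟨W, hW, h⟩ := hmove z hz.1
    refine Filter.mem_of_superset hW fun z' hz' => ?_
    obtain ⟨hz'F, ψ, hψ, rfl, hfix'⟩ := h z' hz'
    refine ⟨hz'F, ?_⟩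
    rintro ⟨φ, hφ, hφz, hfix⟩
    refine hz.2 ⟨φ.trans ψ.symm, trans_mem_SDiff hφ (symm_mem_SDiff hψ), ?_, fun w hw => ?_⟩
    · rw [lift_trans, hφz, lift_symm_lift]
    · rw [lift_trans, hfix w hw]
      conv_lhs => rw [← hfix' w hw]
      exact lift_symm_lift ψ w
  have h := eq_empty_of_isOpen_partition_compl (dense_compl_of_finite hF')
    (fun p _ => exists_isPreconnected_diff hF' p) hA hB disjoint_sdiff_right
    (union_sdiff_cancel hAF) ⟨x, _, refl_mem_SDiff g, lift_refl x, fun z _ => lift_refl z⟩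
  by_contra hc
  exact eq_empty_iff_forall_notMem.1 h x' ⟨hx', hc⟩

/-- Area-preserving diffeomorphisms act transitively on the configurations of `N` oriented points
over distinct points of a connected non-orientable surface. -/
theorem exists_SDiff_lift_eq (g : Metric M) (hM : ¬ IsOrientable M) {N : ℕ}
    {x y : Fin N → OrientationCover M} (hx : x ∈ (collisionSet M N)ᶜ)
    (hy : y ∈ (collisionSet M N)ᶜ) : ∃ φ ∈ SDiff g, ∀ j, lift φ (y j) = x j := by
  have hx' : ∀ i j, i ≠ j → (x i).pt ≠ (x j).pt := fun i j hij h => hx ⟨i, j, hij, h⟩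
  have hy' : ∀ i j, i ≠ j → (y i).pt ≠ (y j).pt := fun i j hij h => hy ⟨i, j, hij, h⟩
  have key : ∀ s : Finset (Fin N), ∃ φ ∈ SDiff g, ∀ j ∈ s, lift φ (y j) = x j := by
    intro s
    induction s using Finset.induction_on with
    | empty => exact ⟨_, refl_mem_SDiff g, by simp⟩
    | insert i s hi ih =>
      obtain ⟨φ, hφ, hφs⟩ := ih
      have hne : ∀ j ∈ s, i ≠ j := fun j hj h => hi (h ▸ hj)
      -- The oriented points over the target positions already reached are held fixed while the next
      -- vortex is moved. Its current position avoids them because φ is injective and the initial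
      -- positions are distinct.
      obtain ⟨ψ, hψ, hψi, hψs⟩ := exists_move_fixing g hM
        (F := (fun j => (x j).pt) '' s) (x := lift φ (y i)) (x' := x i)
        (s.finite_toSet.image _)
        (by
          rintro ⟨j, hj, h⟩
          change (x j).pt = _ at h
          rw [← hφs j hj] at h
          exact hy' i j (hne j hj) (φ.injective h).symm)
        (by
          rintro ⟨j, hj, h⟩
          exact hx' i j (hne j hj) h.symm)
      refine ⟨φ.trans ψ, trans_mem_SDiff hφ hψ, fun j hj => ?_⟩
      rw [lift_trans]
      rcases Finset.mem_insert.1 hj with rfl | hj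
      · exact hψi
      · rw [hφs j hj]
        exact hψs _ ⟨j, hj, rfl⟩
  obtain ⟨φ, hφ, h⟩ := key Finset.univ
  exact ⟨φ, hφ, fun j => h j (Finset.mem_univ j)⟩

end Group

/-! ### Localized twisted test functions -/

section Tests
variable {M : Type*} [TopologicalSpace M] [ChartedSpace Plane M] [IsManifold (𝓡 2) ∞ M]

open Classical in
/-- The function `h`, read in the sheet given by `e` and `o`, continued to a twisted function. -/
def twistedExtend (e : OpenPartialHomeomorph M Plane) (he : e ∈ atlas Plane M)
    (o : Orientation ℝ Plane (Fin 2)) (h : Plane → ℝ) (x : OrientationCover M) : ℝ :=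
  if x ∈ (sheetHomeo e he o).source then h (e x.pt)
  else if x ∈ (sheetHomeo e he (-o)).source then -h (e x.pt) else 0

variable {e : OpenPartialHomeomorph M Plane} (he : e ∈ atlas Plane M)
  {o : Orientation ℝ Plane (Fin 2)} {h : Plane → ℝ} {x : OrientationCover M}

theorem twistedExtend_of_mem (hx : x ∈ (sheetHomeo e he o).source) :
    twistedExtend e he o h x = h (e x.pt) := if_pos hx

theorem twistedExtend_of_mem_neg (hx : x ∈ (sheetHomeo e he (-o)).source) :
    twistedExtend e he o h x = -h (e x.pt) := by
  rw [twistedExtend, if_neg fun h' => (disjoint_sheet he o).le_bot ⟨h', hx⟩, if_pos hx]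

theorem twistedExtend_of_notMem (hx : x.pt ∉ e.symm '' tsupport h) :
    twistedExtend e he o h x = 0 := by
  have h0 : x.pt ∈ e.source → h (e x.pt) = 0 := fun hxe => by
    by_contra hne
    exact hx ⟨e x.pt, subset_tsupport h hne, e.left_inv hxe⟩
  unfold twistedExtend
  split_ifs with h1 h2
  · exact h0 h1.1
  · rw [h0 h2.1, neg_zero]
  · rfl

theorem twistedExtend_flip : twistedExtend e he o h (flip x) = -twistedExtend e he o h x := by
  have hnn : -(-o) = o := neg_neg o
  by_cases hx : x.pt ∈ e.source
  · rcases mem_sheet_or he o hx with h1 | h1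
    · rw [twistedExtend_of_mem he h1, twistedExtend_of_mem_neg he (mem_sheet_flip he h1)]
      rfl
    · have h2 := mem_sheet_flip he h1
      rw [hnn] at h2
      rw [twistedExtend_of_mem_neg he h1, twistedExtend_of_mem he h2, neg_neg]
      rfl
  · have h0 : ∀ z : OrientationCover M, z.pt = x.pt → twistedExtend e he o h z = 0 := by
      intro z hz
      rw [twistedExtend, if_neg fun h' => hx (hz ▸ h'.1), if_neg fun h' => hx (hz ▸ h'.1)]
    rw [h0 x rfl, neg_zero]
    exact h0 _ rfl

theorem contMDiffAt_comp_sheet (hs : ContDiff ℝ ∞ h) (hx : x ∈ (sheetHomeo e he o).source) :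
    ContMDiffAt (𝓡 2) 𝓘(ℝ, ℝ) ∞ (fun z : OrientationCover M => h (e z.pt)) x :=
  hs.contMDiff.contMDiffAt.comp x (contMDiffAt_of_mem_maximalAtlas
    (IsManifold.subset_maximalAtlas (sheetHomeo_mem_atlas e he o)) hx)

/-- On the two opposite sheets the function is `h` or `-h` in coordinates. Elsewhere it vanishes
nearby, since the support projects into a compact, hence closed, subset of the chart domain. -/
theorem contMDiff_twistedExtend [T2Space M] (hs : ContDiff ℝ ∞ h) (hc : HasCompactSupport h)
    (ht : tsupport h ⊆ e.target) : ContMDiff (𝓡 2) 𝓘(ℝ, ℝ) ∞ (twistedExtend e he o h) := by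
  intro x
  by_cases hx : x.pt ∈ e.source
  · rcases mem_sheet_or he o hx with h1 | h1
    · refine (contMDiffAt_comp_sheet he hs h1).congr_of_eventuallyEq ?_
      filter_upwards [(sheetHomeo e he o).open_source.mem_nhds h1] with z hz
      exact twistedExtend_of_mem he hz
    · refine (contMDiffAt_comp_sheet he hs.neg h1).congr_of_eventuallyEq ?_
      filter_upwards [(sheetHomeo e he (-o)).open_source.mem_nhds h1] with z hz
      exact twistedExtend_of_mem_neg he hz
  · have hx' : x.pt ∈ (e.symm '' tsupport h)ᶜ := by
      rintro ⟨y, hy, hyx⟩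
      exact hx (hyx ▸ e.map_target (ht hy))
    have hopen : IsOpen (e.symm '' tsupport h)ᶜ :=
      (isCompact_symm_image hc.isCompact ht).isClosed.isOpen_compl
    refine (contMDiffAt_const (c := (0 : ℝ))).congr_of_eventuallyEq ?_
    filter_upwards [(hopen.preimage continuous_pt).mem_nhds hx'] with z hz
    exact twistedExtend_of_notMem he hz

/-- The support is covered by two compact copies of `tsupport h`, one in each opposite sheet. -/
theorem hasCompactSupport_twistedExtend [T2Space M] (hc : HasCompactSupport h)
    (ht : tsupport h ⊆ e.target) : HasCompactSupport (twistedExtend e he o h) := by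
  have hK : ∀ o', IsCompact ((sheetHomeo e he o').symm '' tsupport h) := fun o' =>
    hc.isCompact.image_of_continuousOn ((sheetHomeo e he o').continuousOn_symm.mono ht)
  refine HasCompactSupport.intro ((hK o).union (hK (-o))) fun x hx => ?_
  refine twistedExtend_of_notMem he ?_
  rintro ⟨y, hy, hyx⟩
  have hxe : x.pt ∈ e.source := hyx ▸ e.map_target (ht hy)
  have hy' : e x.pt = y := by rw [← hyx, e.right_inv (ht hy)]
  rcases mem_sheet_or he o hxe with h1 | h1
  · exact hx (Or.inl ⟨y, hy, by rw [← hy']; exact (sheetHomeo e he o).left_inv h1⟩)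
  · exact hx (Or.inr ⟨y, hy, by rw [← hy']; exact (sheetHomeo e he (-o)).left_inv h1⟩)

/-- A smooth function of the coordinates is near a given oriented point a twisted test function
with support as small as desired. -/
theorem exists_twistedTest [T2Space M] (hx : x ∈ (sheetHomeo e he o).source)
    {k : Plane → ℝ} (hk : ContDiff ℝ ∞ k) {U : Set (OrientationCover M)} (hU : U ∈ 𝓝 x) :
    ∃ f : TwistedTest M, (∀ᶠ z in 𝓝 x, f.1 z = k (e z.pt)) ∧
      ∀ z, f.1 z ≠ 0 → z ∈ U ∨ flip z ∈ U := by
  let S := sheetHomeo e he o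
  have hn : S.target ∩ S.symm ⁻¹' U ∈ 𝓝 (e x.pt) := by
    refine Filter.inter_mem (S.open_target.mem_nhds (S.map_source hx))
      ((S.continuousAt_symm (S.map_source hx)).preimage_mem_nhds ?_)
    rw [S.left_inv hx]
    exact hU
  obtain ⟨r, hr, hrU⟩ := Metric.nhds_basis_closedBall.mem_iff.1 hn
  let χ : ContDiffBump (e x.pt) := ⟨r / 2, r, by positivity, by linarith⟩
  let h : Plane → ℝ := fun y => χ y * k y
  have hh : ContDiff ℝ ∞ h := χ.contDiff.mul hk
  have hsub : tsupport h ⊆ Metric.closedBall (e x.pt) r := by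
    rw [← χ.tsupport_eq]
    exact tsupport_mul_subset_left
  have hc : HasCompactSupport h := χ.hasCompactSupport.mul_right
  have ht : tsupport h ⊆ e.target := fun y hy => (hrU (hsub hy)).1
  refine ⟨⟨twistedExtend e he o h, contMDiff_twistedExtend he hh hc ht,
    hasCompactSupport_twistedExtend he hc ht, fun z => twistedExtend_flip he⟩, ?_, ?_⟩
  · have h1 : ∀ᶠ y in 𝓝 (e x.pt), χ y = 1 := χ.eventuallyEq_one
    filter_upwards [S.open_source.mem_nhds hx, (S.continuousAt hx).eventually h1] with z hz hz1
    have hz1 : χ (e z.pt) = 1 := hz1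
    change twistedExtend e he o h z = _
    rw [twistedExtend_of_mem he hz]
    simp only [h, hz1, one_mul]
  · intro z hz
    by_contra hzU
    refine hz (twistedExtend_of_notMem he ?_)
    rintro ⟨y, hy, hyz⟩
    have hyU := (hrU (hsub hy)).2
    rcases eq_or_eq_flip (x := S.symm y) (y := z) hyz with h2 | h2
    · exact hzU (Or.inl (h2 ▸ hyU))
    · exact hzU (Or.inr (h2 ▸ hyU))

theorem exists_bump [T2Space M] {U : Set (OrientationCover M)} (hU : U ∈ 𝓝 x) :
    ∃ f : TwistedTest M, (∀ᶠ z in 𝓝 x, f.1 z = 1) ∧ ∀ z, f.1 z ≠ 0 → z ∈ U ∨ flip z ∈ U := by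
  obtain ⟨e, he, o, hx⟩ := exists_mem_sheet x
  exact exists_twistedTest he hx (k := fun _ => 1) contDiff_const hU

end Tests

/-! ### Recovering the configuration from its vorticity -/

section Fibres
variable {M : Type*} [TopologicalSpace M] [ChartedSpace Plane M] {N : ℕ} {Γ : Fin N → ℝ}

/-- Two configurations differ by a relabelling of the vortices that respects the strengths. -/
def Relabel (Γ : Fin N → ℝ) (x y : Fin N → OrientationCover M) : Prop :=
  ∃ s : Equiv.Perm (Fin N), ∀ j, (y (s j) = x j ∧ Γ (s j) = Γ j) ∨
    (y (s j) = flip (x j) ∧ Γ (s j) = -Γ j)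

theorem Relabel.mem_compl_collisionSet {x y : Fin N → OrientationCover M} (h : Relabel Γ x y)
    (hy : y ∈ (collisionSet M N)ᶜ) : x ∈ (collisionSet M N)ᶜ := by
  obtain ⟨s, hs⟩ := h
  have hpt : ∀ j, (y (s j)).pt = (x j).pt := by
    intro j
    rcases hs j with ⟨h1, -⟩ | ⟨h1, -⟩ <;> rw [h1]
    rfl
  rintro ⟨i, j, hij, h⟩
  exact hy ⟨s i, s j, fun h' => hij (s.injective h'), by rw [hpt, hpt, h]⟩

/-- Each component of a relabelling is some `y k` or its flip. Finiteness is needed to make the set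
of relabellings closed. -/
theorem finite_relabel (Γ : Fin N → ℝ) (y : Fin N → OrientationCover M) :
    {x | Relabel Γ x y}.Finite := by
  refine (Set.Finite.pi' fun _ : Fin N =>
    (finite_range y).union (finite_range fun k => flip (y k))).subset ?_
  rintro x ⟨s, hs⟩ j
  rcases hs j with ⟨h1, -⟩ | ⟨h1, -⟩
  · exact Or.inl ⟨s j, h1⟩
  · exact Or.inr ⟨s j, by simp only [h1, flip_flip]⟩

theorem exists_disjoint_nhds [T2Space M] {x : Fin N → OrientationCover M} (hx : x ∈ (collisionSet M N)ᶜ) :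
    ∃ D : Fin N → Set M, (∀ j, IsOpen (D j) ∧ (x j).pt ∈ D j) ∧
      ∀ i j p, p ∈ D i → p ∈ D j → i = j := by
  obtain ⟨D, hD, hdis⟩ := (finite_range fun j => (x j).pt).t2_separation
  refine ⟨fun j => D (x j).pt, fun j => ⟨(hD _).2, (hD _).1⟩, fun i j p hi hj => ?_⟩
  by_contra hij
  have hne : (x i).pt ≠ (x j).pt := fun h => hx ⟨i, j, hij, h⟩
  exact (hdis ⟨i, rfl⟩ ⟨j, rfl⟩ hne).le_bot ⟨hi, hj⟩

variable [IsManifold (𝓡 2) ∞ M]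

theorem vorticity_apply (Γ : Fin N → ℝ) (x : Fin N → OrientationCover M) (f : TwistedTest M) :
    vorticity Γ x f = ∑ j, Γ j * f.1 (x j) := by
  simp [vorticity, pointVortex]

theorem continuous_eval (f : TwistedTest M) : Continuous fun T : TwoCurrent M => T f :=
  (continuous_apply f).comp continuous_induced_dom

theorem continuous_vorticity (Γ : Fin N → ℝ) :
    Continuous (vorticity Γ : (Fin N → OrientationCover M) → TwoCurrent M) := by
  refine continuous_induced_rng.2 (continuous_pi fun f => ?_)
  have : ((fun T (f : TwistedTest M) => T f) ∘ vorticity Γ) =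
      fun (x : Fin N → OrientationCover M) (f : TwistedTest M) => ∑ j, Γ j * f.1 (x j) := by
    funext x f
    exact vorticity_apply Γ x f
  rw [this]
  exact continuous_finsetSum _ fun j _ =>
    continuous_const.mul (f.2.1.continuous.comp (continuous_apply j))

theorem Relabel.vorticity_eq {x y : Fin N → OrientationCover M} (h : Relabel Γ x y) :
    vorticity Γ x = vorticity Γ y := by
  obtain ⟨s, hs⟩ := h
  ext f
  rw [vorticity_apply, vorticity_apply, ← Equiv.sum_comp s fun k => Γ k * f.1 (y k)]
  refine Finset.sum_congr rfl fun j _ => ?_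
  rcases hs j with ⟨h1, h2⟩ | ⟨h1, h2⟩
  · rw [h1, h2]
  · rw [h1, h2, f.2.2.2]
    ring

variable [T2Space M]

/-- A configuration whose vorticity is weakly close to that of `x` is a relabelling of one which is
close to `x`. -/
theorem exists_nhds_relabel (hΓ : ∀ j, Γ j ≠ 0) {x : Fin N → OrientationCover M}
    (hx : x ∈ (collisionSet M N)ᶜ) {V : Set (Fin N → OrientationCover M)} (hV : V ∈ 𝓝 x) :
    ∃ T ∈ 𝓝 (vorticity Γ x), ∀ y : Fin N → OrientationCover M, vorticity Γ y ∈ T →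
      ∃ y' ∈ V, Relabel Γ y' y := by
  obtain ⟨D, hD, hdis⟩ := exists_disjoint_nhds hx
  obtain ⟨V', hV', hVV'⟩ : ∃ V' : Fin N → Set (OrientationCover M), (∀ j, V' j ∈ 𝓝 (x j)) ∧
      univ.pi V' ⊆ V := by
    rw [nhds_pi, Filter.mem_pi'] at hV
    obtain ⟨I, t, ht, h⟩ := hV
    exact ⟨t, ht, (pi_mono' (fun _ _ => le_rfl) (subset_univ _)).trans h⟩
  let U : Fin N → Set (OrientationCover M) := fun j => V' j ∩ OrientationCover.pt ⁻¹' D j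
  have hU : ∀ j, U j ∈ 𝓝 (x j) := fun j => Filter.inter_mem (hV' j)
    (((hD j).1.preimage continuous_pt).mem_nhds (hD j).2)
  have hUD : ∀ j z, z ∈ U j ∨ flip z ∈ U j → z.pt ∈ D j := by
    rintro j z (h | h)
    · exact h.2
    · exact h.2
  choose f hf1 hfU using fun j => exists_bump (hU j)
  -- Two nested bumps per vortex: up to a flip, `g j` is supported where `f j` equals 1. Thus `g j`
  -- locates a vortex, and there `f j` reads off its strength up to sign.
  choose g hg1 hgU using fun j => exists_bump (Filter.inter_mem (hf1 j) (hU j))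
  have hfD : ∀ j z, (f j).1 z ≠ 0 → z.pt ∈ D j := fun j z h => hUD j z (hfU j z h)
  have hgD : ∀ j z, (g j).1 z ≠ 0 → z.pt ∈ D j := fun j z h =>
    hUD j z ((hgU j z h).imp And.right And.right)
  have hsingle : ∀ (F : TwistedTest M) (j : Fin N) (y : Fin N → OrientationCover M) (k : Fin N),
      (∀ z, F.1 z ≠ 0 → z.pt ∈ D j) → (∀ i, i ≠ k → (y i).pt ∉ D j) →
      vorticity Γ y F = Γ k * F.1 (y k) := by
    intro F j y k hF hy
    rw [vorticity_apply]
    refine Finset.sum_eq_single k (fun i _ hik => ?_) (fun h => absurd (Finset.mem_univ k) h)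
    rw [not_not.1 fun h => hy i hik (hF _ h), mul_zero]
  have hxD : ∀ j i, i ≠ j → (x i).pt ∉ D j := fun j i hij h => hij (hdis _ _ _ (hD i).2 h)
  -- The finitely many wrong signed strengths. Avoiding this closed set is an open condition, and it
  -- turns approximate equality of strengths into exact equality.
  let Q : Fin N → Set ℝ := fun j => (range Γ ∪ range fun k => -Γ k) \ {Γ j}
  have hQ : ∀ j, IsOpen (Q j)ᶜ := fun j =>
    (((finite_range Γ).union (finite_range fun k => -Γ k)).sdiff).isClosed.isOpen_compl
  have hTf : ∀ j, {T : TwoCurrent M | T (f j) ∈ (Q j)ᶜ} ∈ 𝓝 (vorticity Γ x) := by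
    intro j
    refine ((hQ j).preimage (continuous_eval (f j))).mem_nhds ?_
    change vorticity Γ x (f j) ∈ (Q j)ᶜ
    rw [hsingle (f j) j x j (hfD j) (hxD j), (hf1 j).self_of_nhds, mul_one]
    exact fun h => h.2 rfl
  have hTg : ∀ j, {T : TwoCurrent M | T (g j) ∈ ({0}ᶜ : Set ℝ)} ∈ 𝓝 (vorticity Γ x) := by
    intro j
    refine (isOpen_compl_singleton.preimage (continuous_eval (g j))).mem_nhds ?_
    change vorticity Γ x (g j) ∈ ({0}ᶜ : Set ℝ)
    rw [hsingle (g j) j x j (hgD j) (hxD j), (hg1 j).self_of_nhds, mul_one]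
    exact hΓ j
  refine ⟨_, Filter.iInter_mem.2 fun j => Filter.inter_mem (hTf j) (hTg j), fun y hy => ?_⟩
  have hy' := fun j => mem_iInter.1 hy j
  have hex : ∀ j, ∃ k, (g j).1 (y k) ≠ 0 := by
    intro j
    by_contra! hzero
    refine (hy' j).2 ?_
    rw [mem_singleton_iff, vorticity_apply]
    exact Finset.sum_eq_zero fun k _ => by rw [hzero k, mul_zero]
  choose s hs using hex
  have hsD : ∀ j, (y (s j)).pt ∈ D j := fun j => hgD j _ (hs j)
  -- The sets `D j` are disjoint, so different `j` detect different vortices; as there are only `N`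
  -- of them, each `D j` contains exactly one. No collision hypothesis on `y` is needed.
  have hinj : Function.Injective s := fun i j hij => hdis i j _ (hsD i) (hij ▸ hsD j)
  let σ : Equiv.Perm (Fin N) := Equiv.ofBijective s (Finite.injective_iff_bijective.1 hinj)
  have hyD : ∀ j i, i ≠ s j → (y i).pt ∉ D j := by
    intro j i hij h
    obtain ⟨k, rfl⟩ := σ.surjective i
    exact hij (congrArg s (hdis _ _ _ (hsD k) h))
  have hfy : ∀ j, Γ (s j) * (f j).1 (y (s j)) ∉ Q j := by
    intro j
    rw [← hsingle (f j) j y (s j) (hfD j) (hyD j)]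
    exact (hy' j).1
  have hloc : ∀ j, ∃ z ∈ U j, (y (s j) = z ∧ Γ (s j) = Γ j) ∨
      (y (s j) = flip z ∧ Γ (s j) = -Γ j) := by
    intro j
    have h1 := hfy j
    rcases hgU j _ (hs j) with h | h
    · have h2 : (f j).1 (y (s j)) = 1 := h.1
      rw [h2, mul_one] at h1
      exact ⟨_, h.2, Or.inl ⟨rfl, not_not.1 fun h3 => h1 ⟨Or.inl ⟨s j, rfl⟩, h3⟩⟩⟩
    · have h2 : (f j).1 (flip (y (s j))) = 1 := h.1
      rw [(f j).2.2.2] at h2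
      rw [show (f j).1 (y (s j)) = -1 by linarith, mul_neg_one] at h1
      refine ⟨_, h.2, Or.inr ⟨(flip_flip _).symm, ?_⟩⟩
      have h3 : -Γ (s j) = Γ j := not_not.1 fun h3 => h1 ⟨Or.inr ⟨s j, rfl⟩, h3⟩
      linarith
  choose y' hy'U hrel using hloc
  exact ⟨y', hVV' fun j _ => (hy'U j).1, σ, hrel⟩

/-- Configurations with the same vorticity are relabellings of each other. -/
theorem relabel_of_vorticity_eq (hΓ : ∀ j, Γ j ≠ 0) {x y : Fin N → OrientationCover M}
    (hx : x ∈ (collisionSet M N)ᶜ) (h : vorticity Γ x = vorticity Γ y) : Relabel Γ x y := by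
  by_contra hxy
  -- If `x` is not a relabelling of `y`, then neither is any configuration in a neighbourhood of
  -- `x`; but equal vorticities produce such a relabelling in that neighbourhood.
  obtain ⟨T, hT, hTy⟩ := exists_nhds_relabel hΓ hx
    ((finite_relabel Γ y).isClosed.isOpen_compl.mem_nhds hxy)
  obtain ⟨y', hy', hrel⟩ := hTy y (h ▸ mem_of_mem_nhds hT)
  exact hy' hrel

end Fibres

/-! ### Smoothness and the immersion property -/

section Smooth
variable {M : Type*} [TopologicalSpace M] [ChartedSpace Plane M] [IsManifold (𝓡 2) ∞ M] {N : ℕ}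

/-- The charts of the product are products of charts, so in coordinates this is the local expression
of `f` after a linear projection. -/
theorem contMDiff_comp_coord {f : OrientationCover M → ℝ} (hf : ContMDiff (𝓡 2) 𝓘(ℝ, ℝ) ∞ f)
    (j : Fin N) : ContMDiff (ModelWithCorners.pi fun _ : Fin N => 𝓡 2) 𝓘(ℝ, ℝ) ∞
      (fun x : Fin N → OrientationCover M => f (x j)) := by
  intro x
  have h := (contMDiffAt_iff.1 (hf (x j))).2
  refine contMDiffAt_iff.2 ⟨(hf.continuous.comp (continuous_apply j)).continuousAt, ?_⟩
  refine ContDiffWithinAt.comp (t := range (𝓡 2)) (f := fun w : Fin N → Plane => w j)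
    (g := f ∘ (extChartAt (𝓡 2) (x j)).symm)
    (extChartAt (ModelWithCorners.pi fun _ : Fin N => 𝓡 2) x x) h
    (contDiff_apply ℝ Plane j).contDiffWithinAt fun w _ => by simp

theorem contMDiff_vorticity (Γ : Fin N → ℝ) (f : TwistedTest M) :
    ContMDiff (ModelWithCorners.pi fun _ : Fin N => 𝓡 2) 𝓘(ℝ, ℝ) ∞
      (fun x : Fin N → OrientationCover M => vorticity Γ x f) := by
  simp only [vorticity_apply]
  refine contMDiff_finsetSum fun j _ => ?_
  exact (contMDiff_const (c := Γ j)).mul (contMDiff_comp_coord f.2.1 j)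

theorem dir_eq_zero {f : TwistedTest M} {x : OrientationCover M} (h : ∀ᶠ z in 𝓝 x, f.1 z = 0)
    (v : TangentSpace (𝓡 2) x) : TwistedTest.dir f x v = 0 := by
  have h1 : f.1 =ᶠ[𝓝 x] fun _ => (0 : ℝ) := h
  have h2 := h1.mfderiv_eq (I := 𝓡 2) (I' := 𝓘(ℝ, ℝ))
  rw [mfderiv_const] at h2
  exact DFunLike.congr_fun h2 v

theorem dir_eq_of_chart {f : TwistedTest M} {x : OrientationCover M}
    {e : OpenPartialHomeomorph M Plane} (he : e ∈ atlas Plane M)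
    {o : Orientation ℝ Plane (Fin 2)} (hx : x ∈ (sheetHomeo e he o).source) (ℓ : Plane →L[ℝ] ℝ)
    (h : ∀ᶠ z in 𝓝 x, f.1 z = ℓ (e z.pt)) (v : TangentSpace (𝓡 2) x) :
    TwistedTest.dir f x v = ℓ (mfderiv (𝓡 2) (𝓡 2) (sheetHomeo e he o) x v : Plane) := by
  have h1 : f.1 =ᶠ[𝓝 x] ℓ ∘ sheetHomeo e he o := h
  have h2 := h1.mfderiv_eq (I := 𝓡 2) (I' := 𝓘(ℝ, ℝ))
  rw [mfderiv_comp (I' := 𝓡 2) x ℓ.differentiableAt.mdifferentiableAt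
    (mdifferentiableAt_atlas (sheetHomeo_mem_atlas e he o) hx), mfderiv_eq_fderiv,
    ContinuousLinearMap.fderiv] at h2
  exact DFunLike.congr_fun h2 v

/-- Tangent vectors at a configuration are separated by twisted test functions. -/
theorem tangent_eq_zero [T2Space M] {Γ : Fin N → ℝ} (hΓ : ∀ j, Γ j ≠ 0)
    {x : Fin N → OrientationCover M} (hx : x ∈ (collisionSet M N)ᶜ)
    (v : (j : Fin N) → TangentSpace (𝓡 2) (x j))
    (hv : ∀ f : TwistedTest M, ∑ j, Γ j * TwistedTest.dir f (x j) (v j) = 0) : v = 0 := by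
  obtain ⟨D, hD, hdis⟩ := exists_disjoint_nhds hx
  funext j
  obtain ⟨e, he, o, hxS⟩ := exists_mem_sheet (x j)
  have hU : ∀ i, OrientationCover.pt ⁻¹' D i ∈ 𝓝 (x i) := fun i =>
    ((hD i).1.preimage continuous_pt).mem_nhds (hD i).2
  -- A test function equal to ℓ in the chart near `x j` and vanishing near the other vortices leaves
  -- a single term of the sum. Taking the coordinate functionals for ℓ then kills `v j`.
  have key : ∀ ℓ : Plane →L[ℝ] ℝ,
      ℓ (mfderiv (𝓡 2) (𝓡 2) (sheetHomeo e he o) (x j) (v j) : Plane) = 0 := by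
    intro ℓ
    obtain ⟨f, hf, hfU⟩ := exists_twistedTest he hxS ℓ.contDiff (hU j)
    have h := hv f
    rw [Finset.sum_eq_single j, dir_eq_of_chart he hxS ℓ hf] at h
    · exact (mul_eq_zero.1 h).resolve_left (hΓ j)
    · intro i _ hij
      rw [dir_eq_zero, mul_zero]
      filter_upwards [hU i] with z hz
      by_contra hne
      rcases hfU z hne with h' | h'
      · exact hij (hdis _ _ _ hz h')
      · exact hij (hdis _ _ _ hz h')
    · exact fun h' => absurd (Finset.mem_univ j) h'
  have h0 : (mfderiv (𝓡 2) (𝓡 2) (sheetHomeo e he o) (x j) (v j) : Plane) = 0 := by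
    refine PiLp.ext fun i => ?_
    exact key (EuclideanSpace.proj (𝕜 := ℝ) i)
  have h1 := (mdifferentiable_of_mem_atlas (I := 𝓡 2)
    (sheetHomeo_mem_atlas e he o)).symm_comp_deriv hxS
  refine (DFunLike.congr_fun h1 (v j)).symm.trans ?_
  exact (congrArg (mfderiv (𝓡 2) (𝓡 2) (sheetHomeo e he o).symm (sheetHomeo e he o (x j))) h0).trans
    (map_zero _)

end Smooth

/-! ### Equivariance -/

section Orbit
variable {M : Type*} [TopologicalSpace M] [ChartedSpace Plane M] {N : ℕ}

theorem lift_mem_compl_collisionSet (φ : M ≃ₘ^∞⟮𝓡 2, 𝓡 2⟯ M) {x : Fin N → OrientationCover M}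
    (hx : x ∈ (collisionSet M N)ᶜ) : (fun j => lift φ (x j)) ∈ (collisionSet M N)ᶜ := by
  rintro ⟨i, j, hij, h⟩
  exact hx ⟨i, j, hij, φ.injective h⟩

variable [IsManifold (𝓡 2) ∞ M]

theorem vorticity_eq_pullback {Γ : Fin N → ℝ} {φ : M ≃ₘ^∞⟮𝓡 2, 𝓡 2⟯ M}
    {x y : Fin N → OrientationCover M} (h : ∀ j, lift φ (y j) = x j) :
    vorticity Γ y = pullback φ (vorticity Γ x) := by
  ext f
  change _ = vorticity Γ x (pushTest φ f)
  rw [vorticity_apply, vorticity_apply]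
  refine Finset.sum_congr rfl fun j _ => ?_
  change _ = Γ j * f.1 (lift φ.symm (x j))
  rw [← h j, lift_symm_lift]

end Orbit

end PointVortex

end

/-! ### The parametrization of the orbit -/

theorem mainTheorem7 {M : Type*} [TopologicalSpace M] [T2Space M] [ConnectedSpace M]
    [ChartedSpace PointVortex.Plane M] [IsManifold (𝓡 2) ∞ M] (g : PointVortex.Metric M)
    (hM : ¬ PointVortex.IsOrientable M) (N : ℕ) (Γ : Fin N → ℝ) (hΓ : ∀ j, Γ j ≠ 0)
    (x₀ : Fin N → PointVortex.OrientationCover M)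
    (hx₀ : x₀ ∈ (PointVortex.collisionSet M N)ᶜ) :
    ∃ P : ((PointVortex.collisionSet M N)ᶜ : Set (Fin N → PointVortex.OrientationCover M)) →
        PointVortex.coadjointOrbit g (PointVortex.vorticity Γ x₀),
      -- the map `P` sends a configuration to its vorticity 2-form
      (∀ x, (P x : PointVortex.TwoCurrent M) = PointVortex.vorticity Γ x.1) ∧
      -- it is onto, open and continuous
      IsOpenQuotientMap P ∧
      -- its fibres are the relabellings of the vortices that respect the strengths
      (∀ x y, P x = P y ↔ ∃ s : Equiv.Perm (Fin N), ∀ j,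
        (y.1 (s j) = x.1 j ∧ Γ (s j) = Γ j) ∨
          (y.1 (s j) = PointVortex.OrientationCover.flip (x.1 j) ∧ Γ (s j) = -Γ j)) ∧
      (Function.Injective (fun j => |Γ j|) → IsHomeomorph P) ∧
      -- it is smooth and immersive
      (∀ f : PointVortex.TwistedTest M,
        ContMDiffOn (ModelWithCorners.pi fun _ : Fin N => 𝓡 2) 𝓘(ℝ, ℝ) ∞
          (fun x : Fin N → PointVortex.OrientationCover M => PointVortex.vorticity Γ x f)
          (PointVortex.collisionSet M N)ᶜ) ∧
      (∀ x ∈ (PointVortex.collisionSet M N)ᶜ, ∀ v : (j : Fin N) → TangentSpace (𝓡 2) (x j),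
        (∀ f : PointVortex.TwistedTest M,
          ∑ j, Γ j * PointVortex.TwistedTest.dir f (x j) (v j) = 0) → v = 0) ∧
      -- it is equivariant, and the volume-preserving diffeomorphisms act transitively
      (∀ φ ∈ PointVortex.SDiff g, ∀ x y,
        (∀ j, PointVortex.OrientationCover.lift φ (y.1 j) = x.1 j) →
          (P y : PointVortex.TwoCurrent M) = PointVortex.pullback φ (P x)) ∧
      (∀ x y : ((PointVortex.collisionSet M N)ᶜ : Set (Fin N → PointVortex.OrientationCover M)),
        ∃ φ ∈ PointVortex.SDiff g,
          ∀ j, PointVortex.OrientationCover.lift φ (y.1 j) = x.1 j) := by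
  open PointVortex in
  have horbit : ∀ x : ((collisionSet M N)ᶜ : Set (Fin N → OrientationCover M)),
      vorticity Γ x.1 ∈ coadjointOrbit g (vorticity Γ x₀) := by
    intro x
    obtain ⟨φ, hφ, h⟩ := exists_SDiff_lift_eq g hM hx₀ x.2
    exact ⟨φ, hφ, vorticity_eq_pullback h⟩
  let P : ((PointVortex.collisionSet M N)ᶜ : Set (Fin N → PointVortex.OrientationCover M)) →
      PointVortex.coadjointOrbit g (PointVortex.vorticity Γ x₀) := fun x => ⟨_, horbit x⟩
  have hcont : Continuous P :=
    ((PointVortex.continuous_vorticity Γ).comp continuous_subtype_val).subtype_mk _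
  have hsurj : Function.Surjective P := by
    rintro ⟨_, φ, hφ, rfl⟩
    refine ⟨⟨_, PointVortex.lift_mem_compl_collisionSet φ.symm hx₀⟩, Subtype.ext ?_⟩
    exact PointVortex.vorticity_eq_pullback fun j => PointVortex.lift_lift_symm φ (x₀ j)
  have hfib : ∀ x y, P x = P y ↔ PointVortex.Relabel Γ x.1 y.1 := fun x y =>
    ⟨fun h => PointVortex.relabel_of_vorticity_eq hΓ x.2 (congrArg Subtype.val h),
      fun h => Subtype.ext h.vorticity_eq⟩
  have hopen : IsOpenMap P := by
    intro U hU
    refine isOpen_iff_mem_nhds.2 ?_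
    rintro _ ⟨x, hx, rfl⟩
    obtain ⟨V, hV, rfl⟩ := isOpen_induced_iff.1 hU
    obtain ⟨T, hT, hTV⟩ := PointVortex.exists_nhds_relabel hΓ x.2 (hV.mem_nhds hx)
    filter_upwards [continuous_subtype_val.continuousAt.preimage_mem_nhds hT] with S hS
    -- Only points of the orbit matter, and these come from configurations. A relabelling `y'` of
    -- `y` lies in `V` and has the same vorticity, so it is a preimage of `S` in the given open set.
    obtain ⟨y, rfl⟩ := hsurj S
    obtain ⟨y', hy', hrel⟩ := hTV y.1 hS
    exact ⟨⟨y', hrel.mem_compl_collisionSet y.2⟩, hy', (hfib _ _).2 hrel⟩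
  refine ⟨P, fun _ => rfl, ⟨hsurj, hcont, hopen⟩, hfib, fun habs => ⟨hcont, hopen, ?_, hsurj⟩,
    fun f => (PointVortex.contMDiff_vorticity Γ f).contMDiffOn,
    fun x hx v hv => PointVortex.tangent_eq_zero hΓ hx v hv,
    fun φ _ x y h => PointVortex.vorticity_eq_pullback h,
    fun x y => PointVortex.exists_SDiff_lift_eq g hM x.2 y.2⟩
  intro x y hxy
  obtain ⟨s, hs⟩ := (hfib x y).1 hxy
  refine Subtype.ext (funext fun j => ?_)
  -- Both alternatives preserve |Γ|, so distinct absolute values leave only the identity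
  -- permutation; a flip would then force Γ j = -Γ j, which is excluded as Γ j ≠ 0.
  have hsj : s j = j := habs (by
    rcases hs j with ⟨-, h⟩ | ⟨-, h⟩ <;> simp [h])
  have h := hs j
  rw [hsj] at h
  rcases h with ⟨h, -⟩ | ⟨-, h⟩
  · exact h.symm
  · exact absurd (by linarith) (hΓ j)
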